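/- **Formula for the availability of the 1GnB entanglement buffer.** Let $n\ge 1$, $p_{\mathrm{gen}},p_{\mathrm{con}}\in(0,1]$, $q\in[0,1]$, $\Gamma\ge 0$, $F_{\mathrm{new}}\in(\tfrac14,1]$, and let $a_k,b_k,c_k,d_k$ ($1\le k\le n$) be real coefficients of an arbitrary purification policy: with $p_k(F)=c_k(F-\tfrac14)+d_k$ we have $0\le p_k(F)\le 1$ and $0\le a_k(F-\tfrac14)+b_k\le\tfrac34 p_k(F)$ for all $F\in[\tfrac14,1]$. Put $J_k(F)=\tfrac14+\frac{a_k(F-1/4)+b_k}{c_k(F-1/4)+d_k}$. The 1GnB buffer is the following discrete-time process $(F(t))_{t\ge0}$, where $F(t)$ is the fidelity of the link in the good memory and $F(t)=0$ means that this memory is empty. Initially $F(0)=F_{\mathrm{new}}$. In each time step, independently of the past, a consumption request arrives with probability $p_{\mathrm{con}}$, and each of $n$ bad memories independently generates a link with probability $p_{\mathrm{gen}}$; let $k$ be the number of links generated. If $F(t)=0$, any request is discarded, and $F(t+1)=F_{\mathrm{new}}$ if $k\ge1$, $F(t+1)=0$ if $k=0$. If $F(t)>0$, let $F^-(t+1)=e^{-\Gamma}(F(t)-\tfrac14)+\tfrac14$.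 If a request arrives, the link is consumed, no generation takes place and $F(t+1)=0$. Otherwise, if $k\ge1$, then with probability $q$ purification is attempted; it succeeds with probability $p_k(F^-(t+1))$, giving $F(t+1)=J_k(F^-(t+1))$, and otherwise $F(t+1)=0$. If purification is not attempted, $F(t+1)=F^-(t+1)$. A request in the step from $t$ to $t+1$ is said to arrive at time $t+1$, and finds a link if $F(t)>0$. The availability is $A=\lim_{m\to\infty}\frac1m\sum_{j=1}^m \mathbf 1\{\text{the } j\text{-th request finds a link}\}$. Let $T_{\mathrm{occ}}=\min\{t:F(t)=0\}$ be the time for which the memory stays occupied and $T_{\mathrm{gen}}=\min\{s: F(T_{\mathrm{occ}}+s)>0\}$ the time from when it is emptied until a new link is stored. Then almost surely the limit $A$ exists and $$A=\frac{\mathbb E[T_{\mathrm{occ}}]}{\mathbb E[T_{\mathrm{gen}}]+\mathbb E[T_{\mathrm{occ}}]},$$ where both expectations are finite and $$\mathbb E[T_{\mathrm{gen}}]=\frac{1}{1-(1-p_{\mathrm{gen}})^n},\qquad \mathbb E[T_{\mathrm{occ}}]=\frac{1-\tilde A+\tilde C\,(F_{\mathrm{new}}-\frac14)}{\big[(1-\tilde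 A)(1-\tilde D)-\tilde B\tilde C\big]\tilde P},$$ with $(1-\tilde A)(1-\tilde D)-\tilde B\tilde C\ne0$. Here $$\tilde P=p_{\mathrm{con}}+q\big(1-(1-p_{\mathrm{gen}})^n\big)(1-p_{\mathrm{con}}),$$ $$\tilde A=\frac{q(1-p_{\mathrm{con}})\tilde a}{Q},\quad \tilde B=\frac{q(1-p_{\mathrm{con}})\tilde b}{\tilde P},\quad \tilde C=\frac{q(1-p_{\mathrm{con}})\tilde c}{Q},\quad \tilde D=\frac{q(1-p_{\mathrm{con}})\tilde d}{\tilde P},$$ $$Q=e^{\Gamma}-\big(1-q+q(1-p_{\mathrm{gen}})^n\big)(1-p_{\mathrm{con}}),$$ and $\tilde a=\sum_{k=1}^n a_k\binom nk(1-p_{\mathrm{gen}})^{n-k}p_{\mathrm{gen}}^k$, with $\tilde b,\tilde c,\tilde d$ defined likewise from $b_k,c_k,d_k$. -/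

import Mathlib

open MeasureTheory ProbabilityTheory Filter Topology
open scoped ENNReal

noncomputable section

/-- The four coefficients that determine how a purification protocol acts on a buffered
Werner state. -/
structure PurificationProtocol where
  a : ℝ
  b : ℝ
  c : ℝ
  d : ℝ

namespace PurificationProtocol

/-- Success probability of the protocol, when the buffered link has fidelity `F`. -/
def successProb (π : PurificationProtocol) (F : ℝ) : ℝ :=
  π.c * (F - 1 / 4) + π.d

/-- Jump function: output fidelity of the protocol upon success, when the buffered link has
fidelity `F`. -/
def jump (π : PurificationProtocol) (F : ℝ) : ℝ :=
  1 / 4 + (π.a * (F - 1 / 4) + π.b) / (π.c * (F - 1 / 4) + π.d)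

/-- The coefficients are physical: for every input fidelity `F ∈ [1/4, 1]`, the success
probability lies in `[0, 1]` and the output fidelity lies in `[1/4, 1]`. The latter is written
without the division, `0 ≤ a (F - 1/4) + b ≤ (3/4) p(F)`, so that the numerator vanishes
wherever the success probability does. -/
def IsAdmissible (π : PurificationProtocol) : Prop :=
  ∀ F ∈ Set.Icc (1 / 4 : ℝ) 1,
    π.successProb F ∈ Set.Icc (0 : ℝ) 1 ∧
    π.a * (F - 1 / 4) + π.b ∈ Set.Icc (0 : ℝ) (3 / 4 * π.successProb F)

end PurificationProtocol

/-- The parameters of a 1GnB entanglement buffer. -/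
structure Buffer where
  /-- number of bad (short-lived) memories -/
  n : ℕ
  /-- success probability of entanglement generation in one bad memory, in one time step -/
  pgen : ℝ
  /-- probability that a consumption request arrives in one time step -/
  pcon : ℝ
  /-- probability of attempting purification when new links are available -/
  q : ℝ
  /-- decoherence rate of the good memory -/
  Γ : ℝ
  /-- fidelity of a newly generated link -/
  Fnew : ℝ
  /-- purification policy: `policy k` is the protocol used when `k` new links are available;
  only the values at `1 ≤ k ≤ n` are ever used -/
  policy : ℕ → PurificationProtocol

/-- The elementary random outcomes of one time step, in this order: whether a consumption
request arrives; for each bad memory, whether it generates a link; whether the system chooses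
to purify if it can; a number in `[0, 1]` that decides on the success of the purification. -/
abbrev StepOutcome (n : ℕ) : Type := Bool × (Fin n → Bool) × Bool × ℝ

namespace StepOutcome

variable {n : ℕ}

/-- a consumption request arrives -/
def request (x : StepOutcome n) : Bool := x.1

/-- number of new links generated in the bad memories (if generation takes place) -/
def numLinks (x : StepOutcome n) : ℕ := (Finset.univ.filter fun i => x.2.1 i = true).card

/-- the system chooses to purify (if there is a buffered link and a new one) -/
def purify (x : StepOutcome n) : Bool := x.2.2.1

/-- a purification of success probability `p` succeeds if and only if this number is `< p` -/
def threshold (x : StepOutcome n) : ℝ := x.2.2.2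

end StepOutcome

/-- The law on `Bool` that gives mass `p` to `true` and mass `1 - p` to `false`. -/
def coinLaw (p : ℝ) : Measure Bool :=
  ENNReal.ofReal p • Measure.dirac true + ENNReal.ofReal (1 - p) • Measure.dirac false

namespace Buffer

variable (S : Buffer)

/-- The law of the outcomes of one time step: independent coins, of bias `pcon` for the request,
`pgen` for each of the `n` bad memories, `q` for the choice to purify, and an independent
number uniformly distributed on `[0, 1]`. -/
def stepLaw : Measure (StepOutcome S.n) :=
  (coinLaw S.pcon).prod
    ((Measure.pi fun _ : Fin S.n => coinLaw S.pgen).prod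
      ((coinLaw S.q).prod (volume.restrict (Set.Icc (0 : ℝ) 1))))

/-- Fidelity of a link of fidelity `F` after one time step of depolarising noise. -/
def decohere (F : ℝ) : ℝ := Real.exp (-S.Γ) * (F - 1 / 4) + 1 / 4

/-- One time step of the system: the state is the fidelity of the buffered link, or `0` if the
good memory is empty. -/
def step (F : ℝ) (x : StepOutcome S.n) : ℝ :=
  if F = 0 then
    -- empty memory: a request is discarded, and a new link, if any, is transferred
    if 1 ≤ x.numLinks then S.Fnew else 0
  else if x.request = true then
    -- the buffered link is consumed, which takes up the time step
    0
  else if 1 ≤ x.numLinks ∧ x.purify = true then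
    -- purification is attempted; upon failure all links are discarded
    if x.threshold < (S.policy x.numLinks).successProb (S.decohere F) then
      (S.policy x.numLinks).jump (S.decohere F)
    else 0
  else S.decohere F

variable {Ω : Type*} (X : ℕ → Ω → StepOutcome S.n)

/-- The fidelity process `F(t)`, started from a freshly generated link. Here `X t` holds the
outcomes of the time step from `t` to `t + 1`. -/
def fidelity : ℕ → Ω → ℝ
  | 0, _ => S.Fnew
  | t + 1, ω => S.step (fidelity t ω) (X t ω)

/-- The fidelity `F⁻(t)`, for `t ≥ 1`, of the buffered link at the end of the time step from
`t - 1` to `t`, just before time `t`; it is `0` if the memory was empty. -/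
def fidelityBefore (t : ℕ) (ω : Ω) : ℝ :=
  if S.fidelity X (t - 1) ω = 0 then 0 else S.decohere (S.fidelity X (t - 1) ω)

/-- The arrival time of a consumption request, the requests being numbered from `0`. A request
among the outcomes `X t` of the step from `t` to `t + 1` arrives at time `t + 1`: it finds the
link of fidelity `F⁻(t + 1)`, if there is one, and leaves `F(t + 1) = 0` in that case. -/
def requestTime (j : ℕ) (ω : Ω) : ℕ :=
  Nat.nth (fun t => (X t ω).request = true) j + 1

/-- Fraction of the first `m` consumption requests that find a link in the good memory. -/
def servedFraction (m : ℕ) (ω : Ω) : ℝ :=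
  (1 / (m : ℝ)) * ∑ j ∈ Finset.range m,
    if 0 < S.fidelityBefore X (S.requestTime X j ω) ω then (1 : ℝ) else 0

/-- In the realisation `ω`, the availability exists and equals `A`: infinitely many requests
arrive, and the fraction of the first `m` of them that find a link tends to `A`. -/
def HasAvailability (ω : Ω) (A : ℝ) : Prop :=
  {t : ℕ | (X t ω).request = true}.Infinite ∧
    Tendsto (fun m => S.servedFraction X m ω) atTop (𝓝 A)

/-- The time for which the good memory stays occupied, starting with the link present at time
`0`: the first `t` with `F(t) = 0` (and `⊤` if there is none). -/
def occTime (ω : Ω) : ℕ∞ :=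
  sInf ((fun t : ℕ => (t : ℕ∞)) '' {t : ℕ | S.fidelity X t ω = 0})

/-- The time from when the memory is emptied until a new link is transferred to it (and `⊤` if
there is none). -/
def genTime (ω : Ω) : ℕ∞ :=
  sInf ((fun s : ℕ => (s : ℕ∞)) '' {s : ℕ | 0 < S.fidelity X ((S.occTime X ω).toNat + s) ω})

/-- Expected occupation time, in `[0, ∞]`. -/
def meanOccTime [MeasurableSpace Ω] (P : Measure Ω) : ℝ≥0∞ :=
  ∫⁻ ω, ((S.occTime X ω : ℕ∞) : ℝ≥0∞) ∂P

/-- Expected generation time, in `[0, ∞]`. -/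
def meanGenTime [MeasurableSpace Ω] (P : Measure Ω) : ℝ≥0∞ :=
  ∫⁻ ω, ((S.genTime X ω : ℕ∞) : ℝ≥0∞) ∂P

/-- Binomial average `∑_{k=1}^n f k (n choose k) (1 - pgen)^(n-k) pgen^k`. -/
def binomialAvg (f : ℕ → ℝ) : ℝ :=
  ∑ k ∈ Finset.Icc 1 S.n,
    f k * (S.n.choose k : ℝ) * (1 - S.pgen) ^ (S.n - k) * S.pgen ^ k

def aAvg : ℝ := S.binomialAvg fun k => (S.policy k).a
def bAvg : ℝ := S.binomialAvg fun k => (S.policy k).b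
def cAvg : ℝ := S.binomialAvg fun k => (S.policy k).c
def dAvg : ℝ := S.binomialAvg fun k => (S.policy k).d

def PTilde : ℝ := S.pcon + S.q * (1 - (1 - S.pgen) ^ S.n) * (1 - S.pcon)

def ATilde : ℝ :=
  S.q * (1 - S.pcon) * S.aAvg /
    (Real.exp S.Γ - (1 - S.q + S.q * (1 - S.pgen) ^ S.n) * (1 - S.pcon))

def BTilde : ℝ :=
  S.q * (1 - S.pcon) * S.bAvg / (S.pcon + S.q * (1 - (1 - S.pgen) ^ S.n) * (1 - S.pcon))

def CTilde : ℝ :=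
  S.q * (1 - S.pcon) * S.cAvg /
    (Real.exp S.Γ - (1 - S.q + S.q * (1 - S.pgen) ^ S.n) * (1 - S.pcon))

def DTilde : ℝ :=
  S.q * (1 - S.pcon) * S.dAvg / (S.pcon + S.q * (1 - (1 - S.pgen) ^ S.n) * (1 - S.pcon))

end Buffer

end

/-! The key is that one time step acts linearly on affine functions of the fidelity. The jump
function has the success probability as its denominator, so success probability times an affine
function of the output fidelity is again affine in the input fidelity. Hence the equation "expected
value after one step = value - 1" in the occupied states, with value `0` in the empty state, has an
affine solution `V` (`occValue`) as soon as a 2×2 linear system is solvable. Its determinant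
`occDet` is nonzero because a kernel vector would be an affine function fixed by an operator that
shrinks the supremum norm by the factor `1 - pcon < 1`.

Summing that equation along the process identifies the mean occupation time: it is the sum of the
probabilities of being occupied up to `t`, and this sum telescopes to `V(Fnew)`. A similar
telescoping gives the mean generation time `1 / genProb`.

The availability is obtained without renewal theory. For `a` the claimed value, the summand "request
× (occupied - a)" plus `pcon * (1 - a)` times the increment of `V` has conditional mean zero in
every state; in the empty state this is exactly the equation that determines `a`. Such summands are
bounded and pairwise orthogonal, so their averages vanish almost surely, and the bounded increments
of `V` telescope away. Dividing by the density `pcon` of the requests turns time averages into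
averages over requests. -/

/-! ### Admissible protocols and the state space -/

namespace PurificationProtocol

variable {π : PurificationProtocol} {F : ℝ}

theorem IsAdmissible.jump_mem (hπ : π.IsAdmissible) (hF : F ∈ Set.Icc (1 / 4 : ℝ) 1) :
    π.jump F ∈ Set.Icc (1 / 4 : ℝ) 1 := by
  obtain ⟨⟨h0, -⟩, h2, h3⟩ := hπ F hF
  -- If the success probability is `0`, the quotient is `0` by convention and the bound still holds.
  have hle : (π.a * (F - 1 / 4) + π.b) / π.successProb F ≤ 3 / 4 :=
    div_le_of_le_mul₀ h0 (by norm_num) h3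
  have hnn : 0 ≤ (π.a * (F - 1 / 4) + π.b) / π.successProb F := div_nonneg h2 h0
  have hj : π.jump F = 1 / 4 + (π.a * (F - 1 / 4) + π.b) / π.successProb F := rfl
  rw [hj]
  constructor <;> linarith

/-- The denominator of the jump function cancels, which is what keeps the one-step operator within
affine functions. Where the success probability vanishes, admissibility forces the numerator to
vanish too, so both sides are `0`. -/
theorem IsAdmissible.successProb_mul_affine (hπ : π.IsAdmissible)
    (hF : F ∈ Set.Icc (1 / 4 : ℝ) 1) (α β : ℝ) :
    π.successProb F * (α * (π.jump F - 1 / 4) + β) =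
      α * (π.a * (F - 1 / 4) + π.b) + β * (π.c * (F - 1 / 4) + π.d) := by
  obtain ⟨-, h2, h3⟩ := hπ F hF
  have hs : π.c * (F - 1 / 4) + π.d = π.successProb F := rfl
  simp only [jump, hs, add_sub_cancel_left]
  by_cases h : π.successProb F = 0
  · rw [h, mul_zero] at h3
    rw [h, le_antisymm h3 h2]
    simp
  · field_simp

end PurificationProtocol

theorem StepOutcome.numLinks_le {n : ℕ} (x : StepOutcome n) : x.numLinks ≤ n :=
  (Finset.card_filter_le _ _).trans_eq (Finset.card_fin n)

namespace Buffer

/-- The parameters of the buffer lie in their physical ranges. -/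
structure IsPhysical (S : Buffer) : Prop where
  n_pos : 1 ≤ S.n
  pgen_mem : S.pgen ∈ Set.Ioc (0 : ℝ) 1
  pcon_mem : S.pcon ∈ Set.Ioc (0 : ℝ) 1
  q_mem : S.q ∈ Set.Icc (0 : ℝ) 1
  Γ_nonneg : 0 ≤ S.Γ
  Fnew_mem : S.Fnew ∈ Set.Ioc (1 / 4 : ℝ) 1
  admissible : ∀ k ∈ Finset.Icc 1 S.n, (S.policy k).IsAdmissible

/-- The probability that at least one bad memory generates a link in one time step. -/
noncomputable def genProb (S : Buffer) : ℝ := 1 - (1 - S.pgen) ^ S.n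

/-- The determinant of the linear system for the expected occupation time. -/
noncomputable def occDet (S : Buffer) : ℝ :=
  (1 - S.ATilde) * (1 - S.DTilde) - S.BTilde * S.CTilde

variable {S : Buffer}

theorem IsPhysical.genProb_pos (h : S.IsPhysical) : 0 < S.genProb :=
  sub_pos.2 (pow_lt_one₀ (by linarith [h.pgen_mem.2]) (by linarith [h.pgen_mem.1])
    (by have := h.n_pos; omega))

theorem IsPhysical.genProb_le_one (h : S.IsPhysical) : S.genProb ≤ 1 :=
  sub_le_self _ (pow_nonneg (by linarith [h.pgen_mem.2]) _)

theorem IsPhysical.Fnew_mem_Icc (h : S.IsPhysical) : S.Fnew ∈ Set.Icc (1 / 4 : ℝ) 1 :=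
  Set.Ioc_subset_Icc_self h.Fnew_mem

theorem IsPhysical.decohere_mem (h : S.IsPhysical) {F : ℝ} (hF : F ∈ Set.Icc (1 / 4 : ℝ) 1) :
    S.decohere F ∈ Set.Icc (1 / 4 : ℝ) 1 := by
  have h1 : Real.exp (-S.Γ) ≤ 1 := Real.exp_le_one_iff.2 (by linarith [h.Γ_nonneg])
  have h2 := Real.exp_pos (-S.Γ)
  obtain ⟨hF1, hF2⟩ := hF
  unfold decohere
  constructor <;> nlinarith

/-- The values that the fidelity process can take. -/
def stateSet : Set ℝ := {F | F = 0 ∨ F ∈ Set.Icc (1 / 4 : ℝ) 1}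

theorem IsPhysical.step_mem (h : S.IsPhysical) {F : ℝ} (hF : F ∈ stateSet)
    (x : StepOutcome S.n) : S.step F x ∈ stateSet := by
  unfold step
  rcases hF with rfl | hF
  · rw [if_pos rfl]
    split_ifs
    · exact Or.inr h.Fnew_mem_Icc
    · exact Or.inl rfl
  · have h0 : F ≠ 0 := by rintro rfl; norm_num at hF
    rw [if_neg h0]
    split_ifs with h1 h2 h3
    · exact Or.inl rfl
    · exact Or.inr ((h.admissible _ (Finset.mem_Icc.2 ⟨h2.1, x.numLinks_le⟩)).jump_mem
        (h.decohere_mem hF))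
    · exact Or.inl rfl
    · exact Or.inr (h.decohere_mem hF)

theorem IsPhysical.fidelity_mem (h : S.IsPhysical) {Ω : Type*} (X : ℕ → Ω → StepOutcome S.n)
    (t : ℕ) (ω : Ω) : S.fidelity X t ω ∈ stateSet := by
  induction t with
  | zero => exact Or.inr h.Fnew_mem_Icc
  | succ t ih => exact h.step_mem ih _

theorem ne_zero_of_mem_Icc {F : ℝ} (hF : F ∈ Set.Icc (1 / 4 : ℝ) 1) : F ≠ 0 := by
  rintro rfl; norm_num at hF

theorem pos_iff_of_mem_stateSet {F : ℝ} (hF : F ∈ stateSet) : 0 < F ↔ F ≠ 0 := by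
  rcases hF with rfl | hF
  · simp
  · exact ⟨fun h => h.ne', fun _ => by linarith [hF.1]⟩

/-! ### The linear system for the expected occupation time -/

theorem IsPhysical.PTilde_pos (h : S.IsPhysical) : 0 < S.PTilde := by
  have h1 := h.genProb_pos
  have h2 := h.q_mem.1
  have h3 : 0 ≤ 1 - S.pcon := by linarith [h.pcon_mem.2]
  have := h.pcon_mem.1
  have : 0 ≤ S.q * S.genProb * (1 - S.pcon) := by positivity
  unfold PTilde
  unfold genProb at this
  linarith

/-- Since `exp Γ ≥ 1`, this denominator is at least `PTilde`. -/
theorem IsPhysical.exp_sub_pos (h : S.IsPhysical) :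
    0 < Real.exp S.Γ - (1 - S.q + S.q * (1 - S.pgen) ^ S.n) * (1 - S.pcon) := by
  have h1 := h.PTilde_pos
  have h2 : 1 ≤ Real.exp S.Γ := Real.one_le_exp h.Γ_nonneg
  unfold PTilde at h1
  linarith

/-- An affine function whose coefficients solve the linear system is, up to the constant `r`,
a fixed point of the one-step operator. -/
theorem IsPhysical.affine_fixedPoint (h : S.IsPhysical) {α β r : ℝ}
    (hα : α = S.ATilde * α + S.CTilde * β)
    (hβ : β = S.BTilde * α + S.DTilde * β + r / S.PTilde) (x : ℝ) :
    α * x + β = r + (1 - S.pcon) * ((1 - S.q * S.genProb) * (α * (Real.exp (-S.Γ) * x) + β) +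
      S.q * (α * (S.aAvg * (Real.exp (-S.Γ) * x) + S.bAvg) +
        β * (S.cAvg * (Real.exp (-S.Γ) * x) + S.dAvg))) := by
  have hQ := h.exp_sub_pos.ne'
  have hP := h.PTilde_pos.ne'
  have hee : Real.exp (-S.Γ) * Real.exp S.Γ = 1 := by rw [← Real.exp_add]; simp
  -- Comparing coefficients: `hα'` is the coefficient of `x`, multiplied by `exp Γ`, and `hβ'` is
  -- the constant term. The part without purification has been moved to the left in both.
  have hα' : α * (Real.exp S.Γ - (1 - S.q + S.q * (1 - S.pgen) ^ S.n) * (1 - S.pcon)) =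
      S.q * (1 - S.pcon) * (S.aAvg * α + S.cAvg * β) := by
    unfold ATilde CTilde at hα
    generalize Real.exp S.Γ - (1 - S.q + S.q * (1 - S.pgen) ^ S.n) * (1 - S.pcon) = Q at hα hQ ⊢
    calc α * Q = (S.q * (1 - S.pcon) * S.aAvg / Q * α + S.q * (1 - S.pcon) * S.cAvg / Q * β) * Q :=
          congrArg (· * Q) hα
      _ = _ := by field_simp
  have hβ' : β * S.PTilde = S.q * (1 - S.pcon) * (S.bAvg * α + S.dAvg * β) + r := by
    have hB : S.BTilde = S.q * (1 - S.pcon) * S.bAvg / S.PTilde := rfl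
    have hD : S.DTilde = S.q * (1 - S.pcon) * S.dAvg / S.PTilde := rfl
    rw [hB, hD] at hβ
    generalize S.PTilde = Q at hβ hP ⊢
    calc β * Q = (S.q * (1 - S.pcon) * S.bAvg / Q * α + S.q * (1 - S.pcon) * S.dAvg / Q * β
          + r / Q) * Q := congrArg (· * Q) hβ
      _ = _ := by field_simp
  unfold PTilde at hβ'
  unfold genProb
  linear_combination x * Real.exp (-S.Γ) * hα' + hβ' - α * x * hee

theorem binomialAvg_mono (h : S.IsPhysical) {f g : ℕ → ℝ}
    (hfg : ∀ k ∈ Finset.Icc 1 S.n, f k ≤ g k) : S.binomialAvg f ≤ S.binomialAvg g := by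
  refine Finset.sum_le_sum fun k hk => ?_
  have h1 : 0 ≤ 1 - S.pgen := by linarith [h.pgen_mem.2]
  have h2 := h.pgen_mem.1.le
  gcongr
  exact hfg k hk

theorem binomialAvg_const (c : ℝ) : S.binomialAvg (fun _ => c) = c * S.genProb := by
  have h := add_pow S.pgen (1 - S.pgen) S.n
  rw [add_sub_cancel, one_pow, Finset.range_eq_Ico,
    Finset.sum_eq_sum_Ico_succ_bot (Nat.succ_pos _)] at h
  have h2 : S.genProb = ∑ k ∈ Finset.Icc 1 S.n,
      S.pgen ^ k * (1 - S.pgen) ^ (S.n - k) * (S.n.choose k : ℝ) := by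
    have : Finset.Ico (0 + 1) (S.n + 1) = Finset.Icc 1 S.n := by ext; simp
    rw [this] at h
    simp only [pow_zero, one_mul, Nat.sub_zero, Nat.choose_zero_right, Nat.cast_one,
      mul_one] at h
    unfold genProb
    linarith
  rw [h2, binomialAvg, Finset.mul_sum]
  exact Finset.sum_congr rfl fun k _ => by ring

theorem binomialAvg_affine (α β y : ℝ) :
    S.binomialAvg (fun k => α * ((S.policy k).a * y + (S.policy k).b) +
      β * ((S.policy k).c * y + (S.policy k).d)) =
    α * (S.aAvg * y + S.bAvg) + β * (S.cAvg * y + S.dAvg) := by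
  simp only [aAvg, bAvg, cAvg, dAvg, binomialAvg, Finset.mul_sum, Finset.sum_mul,
    ← Finset.sum_add_distrib]
  exact Finset.sum_congr rfl fun k _ => by ring

/-- The modulus of an affine function is convex, hence maximal at an endpoint. The variable `x`
stands for `F - 1/4`. -/
theorem abs_affine_le {α β x : ℝ} (hx : x ∈ Set.Icc (0 : ℝ) (3 / 4)) :
    |α * x + β| ≤ max |β| |α * (3 / 4) + β| := by
  have h1 := le_max_left |β| |α * (3 / 4) + β|
  have h2 := le_max_right |β| |α * (3 / 4) + β|
  set M := max |β| |α * (3 / 4) + β|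
  obtain ⟨hx0, hx1⟩ := hx
  rw [abs_le] at *
  constructor <;> rcases le_total 0 α with ha | ha <;> nlinarith

/-- A kernel vector gives an affine function that satisfies the one-step equation with `r = 0`. A
request kills the value, and otherwise the new value is a sub-average of old ones, so the supremum
`M` satisfies `M ≤ (1 - pcon) * M`. Thus `M = 0` and the function vanishes at both endpoints. -/
theorem IsPhysical.occDet_ne_zero (h : S.IsPhysical) : S.occDet ≠ 0 := by
  intro hdet
  obtain ⟨v, hv0, hv⟩ := Matrix.exists_mulVec_eq_zero_iff (M :=
    !![1 - S.ATilde, -S.CTilde; -S.BTilde, 1 - S.DTilde]) |>.2 (by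
      rw [Matrix.det_fin_two_of]; unfold occDet at hdet; linarith)
  have e0 := congrFun hv 0
  have e1 := congrFun hv 1
  simp [Matrix.mulVec, dotProduct, Fin.sum_univ_two] at e0 e1
  set α := v 0
  set β := v 1
  have fix := h.affine_fixedPoint (α := α) (β := β) (r := 0) (by linarith)
    (by rw [zero_div]; linarith)
  set M := max |β| |α * (3 / 4) + β|
  have hM0 : 0 ≤ M := (abs_nonneg _).trans (le_max_left _ _)
  have hp0 := h.pcon_mem.1
  have hp1 : 0 ≤ 1 - S.pcon := by linarith [h.pcon_mem.2]
  have hq0 := h.q_mem.1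
  have hqg : 0 ≤ 1 - S.q * S.genProb := by
    nlinarith [h.q_mem.2, h.genProb_le_one, h.genProb_pos]
  have key : ∀ x ∈ Set.Icc (0 : ℝ) (3 / 4), |α * x + β| ≤ (1 - S.pcon) * M := by
    intro x hx
    have hmem : x + 1 / 4 ∈ Set.Icc (1 / 4 : ℝ) 1 := ⟨by linarith [hx.1], by linarith [hx.2]⟩
    have hd := h.decohere_mem hmem
    have hdx : S.decohere (x + 1 / 4) = Real.exp (-S.Γ) * x + 1 / 4 := by
      unfold decohere; ring
    rw [hdx] at hd
    set y := Real.exp (-S.Γ) * x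
    have hy : y ∈ Set.Icc (0 : ℝ) (3 / 4) := ⟨by linarith [hd.1], by linarith [hd.2]⟩
    have hterm : ∀ k ∈ Finset.Icc 1 S.n,
        |α * ((S.policy k).a * y + (S.policy k).b) +
          β * ((S.policy k).c * y + (S.policy k).d)| ≤ M := by
      intro k hk
      have e := (h.admissible k hk).successProb_mul_affine hd α β
      have hj := (h.admissible k hk).jump_mem hd
      have hs := (h.admissible k hk _ hd).1
      rw [add_sub_cancel_right] at e
      rw [← e, abs_mul, abs_of_nonneg hs.1]
      have := abs_affine_le (α := α) (β := β) (x := (S.policy k).jump (y + 1 / 4) - 1 / 4)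
        ⟨by linarith [hj.1], by linarith [hj.2]⟩
      calc _ ≤ 1 * M := mul_le_mul hs.2 this (abs_nonneg _) zero_le_one
        _ = M := one_mul M
    -- The binomial weights over `k ≥ 1` sum to `genProb`; together with the weight `1 - q *
    -- genProb` of plain decoherence the total is `1`.
    have havg : |α * (S.aAvg * y + S.bAvg) + β * (S.cAvg * y + S.dAvg)| ≤ M * S.genProb := by
      rw [← binomialAvg_affine, ← binomialAvg_const, abs_le]
      constructor
      · rw [binomialAvg_const, ← neg_mul, ← binomialAvg_const]
        exact binomialAvg_mono h fun k hk => (abs_le.1 (hterm k hk)).1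
      · exact binomialAvg_mono h fun k hk => (abs_le.1 (hterm k hk)).2
    rw [fix x, zero_add, abs_mul, abs_of_nonneg hp1]
    refine mul_le_mul_of_nonneg_left ?_ hp1
    refine (abs_add_le _ _).trans ?_
    rw [abs_mul, abs_mul, abs_of_nonneg hqg, abs_of_nonneg hq0]
    have := mul_le_mul_of_nonneg_left (abs_affine_le (α := α) (β := β) hy) hqg
    have := mul_le_mul_of_nonneg_left havg hq0
    linarith
  have hMle : M ≤ (1 - S.pcon) * M := max_le (by simpa using key 0 ⟨le_rfl, by norm_num⟩)
    (key (3 / 4) ⟨by norm_num, le_rfl⟩)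
  have hMz : M = 0 := by nlinarith
  have hβ : β = 0 := abs_nonpos_iff.1 ((le_max_left _ _).trans_eq hMz)
  have hα : α * (3 / 4) + β = 0 := abs_nonpos_iff.1 ((le_max_right _ _).trans_eq hMz)
  refine hv0 (funext fun i => ?_)
  fin_cases i
  · change α = 0
    linarith
  · exact hβ

/-- Slope of the expected occupation time as a function of the initial fidelity. -/
noncomputable def occSlope (S : Buffer) : ℝ := S.CTilde / (S.occDet * S.PTilde)

/-- Expected occupation time for the initial fidelity `1 / 4`. -/
noncomputable def occIntercept (S : Buffer) : ℝ := (1 - S.ATilde) / (S.occDet * S.PTilde)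

theorem occSlope_eq :
    S.occSlope = S.ATilde * S.occSlope + S.CTilde * S.occIntercept := by
  unfold occSlope occIntercept; ring

/-- Slope and intercept come from Cramer's rule, with right-hand side `(0, 1 / PTilde)`; this is the
second equation of the system. -/
theorem IsPhysical.occIntercept_eq (h : S.IsPhysical) :
    S.occIntercept = S.BTilde * S.occSlope + S.DTilde * S.occIntercept + 1 / S.PTilde := by
  have h1 := h.occDet_ne_zero
  have h2 := h.PTilde_pos.ne'
  unfold occSlope occIntercept
  field_simp
  unfold occDet
  ring

/-- Expected remaining occupation time of the good memory in the state `F`. -/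
noncomputable def occValue (S : Buffer) (F : ℝ) : ℝ :=
  if F = 0 then 0 else S.occSlope * (F - 1 / 4) + S.occIntercept

theorem occValue_of_mem {F : ℝ} (hF : F ∈ Set.Icc (1 / 4 : ℝ) 1) :
    S.occValue F = S.occSlope * (F - 1 / 4) + S.occIntercept :=
  if_neg (ne_zero_of_mem_Icc hF)

theorem occValue_zero : S.occValue 0 = 0 := if_pos rfl

theorem abs_occValue_le {F : ℝ} (hF : F ∈ stateSet) :
    |S.occValue F| ≤ max |S.occIntercept| |S.occSlope * (3 / 4) + S.occIntercept| := by
  rcases hF with rfl | hF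
  · rw [occValue_zero, abs_zero]
    exact (abs_nonneg _).trans (le_max_left _ _)
  · rw [occValue_of_mem hF]
    exact abs_affine_le ⟨by linarith [hF.1], by linarith [hF.2]⟩

end Buffer

/-! ### Integrals against the elementary laws -/

theorem isProbabilityMeasure_coinLaw {p : ℝ} (hp : p ∈ Set.Icc (0 : ℝ) 1) :
    IsProbabilityMeasure (coinLaw p) := by
  refine ⟨?_⟩
  simp only [coinLaw, Measure.coe_add, Measure.coe_smul, Pi.add_apply, Pi.smul_apply,
    measure_univ, smul_eq_mul, mul_one]
  rw [← ENNReal.ofReal_add hp.1 (by linarith [hp.2])]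
  simp

theorem coinLaw_real_singleton {p : ℝ} (hp : p ∈ Set.Icc (0 : ℝ) 1) (b : Bool) :
    (coinLaw p).real {b} = if b = true then p else 1 - p := by
  have h1 := hp.1
  have h2 : 0 ≤ 1 - p := by linarith [hp.2]
  cases b <;> simp [coinLaw, measureReal_def, h1, h2]

theorem integral_coinLaw {p : ℝ} (hp : p ∈ Set.Icc (0 : ℝ) 1) (f : Bool → ℝ) :
    ∫ b, f b ∂(coinLaw p) = p * f true + (1 - p) * f false := by
  have := isProbabilityMeasure_coinLaw hp
  rw [integral_fintype .of_finite]
  simp [coinLaw_real_singleton hp]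

/-- The number of successes among independent coins has a binomial distribution. -/
theorem integral_pi_coinLaw {n : ℕ} {p : ℝ} (hp : p ∈ Set.Icc (0 : ℝ) 1) (f : ℕ → ℝ) :
    ∫ x, f (Finset.univ.filter fun i => x i = true).card
        ∂(Measure.pi fun _ : Fin n => coinLaw p) =
      ∑ k ∈ Finset.range (n + 1), f k * (n.choose k : ℝ) * (1 - p) ^ (n - k) * p ^ k := by
  have := isProbabilityMeasure_coinLaw hp
  rw [integral_fintype .of_finite]
  have hsing (x : Fin n → Bool) : (Measure.pi fun _ : Fin n => coinLaw p).real {x} =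
      p ^ (Finset.univ.filter fun i => x i = true).card *
        (1 - p) ^ (n - (Finset.univ.filter fun i => x i = true).card) := by
    rw [measureReal_def, Measure.pi_singleton, ENNReal.toReal_prod]
    have h1 : ∀ i, ((coinLaw p) {x i}).toReal = if x i = true then p else 1 - p :=
      fun i => coinLaw_real_singleton hp (x i)
    simp only [h1]
    rw [Finset.prod_ite, Finset.prod_const, Finset.prod_const, Finset.filter_not,
      Finset.card_sdiff_of_subset (Finset.filter_subset _ _), Finset.card_univ, Fintype.card_fin]
  simp only [hsing, smul_eq_mul]
  -- Coin outcomes correspond to subsets of `Fin n`, and the summand depends only on the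
  -- cardinality.
  have e := Finset.sum_powerset_apply_card (fun k => p ^ k * (1 - p) ^ (n - k) * f k)
    (x := (Finset.univ : Finset (Fin n)))
  rw [Finset.card_univ, Fintype.card_fin] at e
  rw [Finset.sum_congr rfl (g := fun k => n.choose k • (p ^ k * (1 - p) ^ (n - k) * f k))
    (fun k _ => by rw [nsmul_eq_mul]; ring), ← e, Finset.powerset_univ]
  refine Finset.sum_bij (fun x _ => Finset.univ.filter fun i => x i = true)
    (fun _ _ => Finset.mem_univ _) (fun x _ y _ hxy => ?_) (fun s _ => ?_) (fun _ _ => rfl)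
  · funext i
    have := Finset.ext_iff.1 hxy i
    simp only [Finset.mem_filter, Finset.mem_univ, true_and] at this
    exact Bool.eq_iff_iff.2 this
  · exact ⟨fun i => decide (i ∈ s), Finset.mem_univ _, by ext; simp⟩

theorem integral_threshold {p : ℝ} (hp : p ∈ Set.Icc (0 : ℝ) 1) (c : ℝ) :
    ∫ u in Set.Icc (0 : ℝ) 1, (if u < p then c else 0) = p * c := by
  have h1 : (fun u : ℝ => if u < p then c else 0) = (Set.Iio p).indicator fun _ => c := by
    ext u; simp [Set.indicator_apply]
  rw [h1, integral_indicator measurableSet_Iio, Measure.restrict_restrict measurableSet_Iio,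
    setIntegral_const, smul_eq_mul]
  have h2 : Set.Iio p ∩ Set.Icc 0 1 = Set.Ico 0 p := by
    ext u
    simp only [Set.mem_inter_iff, Set.mem_Iio, Set.mem_Icc, Set.mem_Ico]
    exact ⟨fun h => ⟨h.2.1, h.1⟩, fun h => ⟨h.2, h.1, h.2.le.trans hp.2⟩⟩
  rw [h2, measureReal_def, Real.volume_Ico, sub_zero, ENNReal.toReal_ofReal hp.1]

namespace StepOutcome

variable {n : ℕ}

theorem measurable_request : Measurable (request : StepOutcome n → Bool) := measurable_fst

theorem measurable_numLinks : Measurable (numLinks : StepOutcome n → ℕ) :=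
  (measurable_of_finite fun y : Fin n → Bool =>
    (Finset.univ.filter fun i => y i = true).card).comp (measurable_fst.comp measurable_snd)

theorem measurable_purify : Measurable (purify : StepOutcome n → Bool) :=
  measurable_fst.comp (measurable_snd.comp measurable_snd)

theorem measurable_threshold : Measurable (threshold : StepOutcome n → ℝ) :=
  measurable_snd.comp (measurable_snd.comp measurable_snd)

end StepOutcome

/-! ### Expectations over one time step -/

namespace Buffer

variable {S : Buffer}

open StepOutcome in
theorem measurable_step : Measurable fun z : ℝ × StepOutcome S.n => S.step z.1 z.2 := by
  have hN : Measurable fun z : ℝ × StepOutcome S.n => z.2.numLinks :=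
    measurable_numLinks.comp measurable_snd
  have hR : Measurable fun z : ℝ × StepOutcome S.n => z.2.request :=
    measurable_request.comp measurable_snd
  have hB : Measurable fun z : ℝ × StepOutcome S.n => z.2.purify :=
    measurable_purify.comp measurable_snd
  have hT : Measurable fun z : ℝ × StepOutcome S.n => z.2.threshold :=
    measurable_threshold.comp measurable_snd
  have hpol (f : PurificationProtocol → ℝ) :
      Measurable fun z : ℝ × StepOutcome S.n => f (S.policy z.2.numLinks) :=
    (measurable_from_top (f := fun k => f (S.policy k))).comp hN
  have ha := hpol fun π => π.a
  have hb := hpol fun π => π.b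
  have hc := hpol fun π => π.c
  have hd := hpol fun π => π.d
  have hdec : Measurable fun z : ℝ × StepOutcome S.n => S.decohere z.1 := by
    unfold decohere; fun_prop
  have hN1 : MeasurableSet {z : ℝ × StepOutcome S.n | 1 ≤ z.2.numLinks} :=
    measurableSet_le measurable_const hN
  have hR1 : MeasurableSet {z : ℝ × StepOutcome S.n | z.2.request = true} :=
    hR (measurableSet_singleton true)
  have hB1 : MeasurableSet {z : ℝ × StepOutcome S.n | z.2.purify = true} :=
    hB (measurableSet_singleton true)
  unfold step
  refine Measurable.ite (measurable_fst (measurableSet_singleton (0 : ℝ))) ?_ ?_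
  · exact Measurable.ite hN1 measurable_const measurable_const
  refine Measurable.ite hR1 measurable_const ?_
  refine Measurable.ite (hN1.inter hB1) ?_ hdec
  refine Measurable.ite (measurableSet_lt hT ?_) ?_ measurable_const
  · unfold PurificationProtocol.successProb; fun_prop
  · unfold PurificationProtocol.jump; fun_prop

theorem measurable_occValue : Measurable S.occValue :=
  Measurable.ite (measurableSet_singleton (0 : ℝ)) measurable_const (by fun_prop)

theorem IsPhysical.isProbabilityMeasure_stepLaw (h : S.IsPhysical) :
    IsProbabilityMeasure S.stepLaw := by
  have := isProbabilityMeasure_coinLaw (Set.Ioc_subset_Icc_self h.pcon_mem)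
  have := isProbabilityMeasure_coinLaw (Set.Ioc_subset_Icc_self h.pgen_mem)
  have := isProbabilityMeasure_coinLaw h.q_mem
  have : IsProbabilityMeasure (volume.restrict (Set.Icc (0 : ℝ) 1)) := ⟨by simp⟩
  unfold stepLaw
  infer_instance

/-- Expectation of a function of the outcomes of one time step. -/
theorem IsPhysical.integral_stepLaw (h : S.IsPhysical) {G : StepOutcome S.n → ℝ}
    (hG : Measurable G) {C : ℝ} (hC : ∀ x, |G x| ≤ C) :
    ∫ x, G x ∂S.stepLaw =
      S.pcon * ∫ y, (S.q * (∫ u in Set.Icc (0 : ℝ) 1, G (true, y, true, u)) +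
        (1 - S.q) * ∫ u in Set.Icc (0 : ℝ) 1, G (true, y, false, u))
          ∂(Measure.pi fun _ : Fin S.n => coinLaw S.pgen) +
      (1 - S.pcon) * ∫ y, (S.q * (∫ u in Set.Icc (0 : ℝ) 1, G (false, y, true, u)) +
        (1 - S.q) * ∫ u in Set.Icc (0 : ℝ) 1, G (false, y, false, u))
          ∂(Measure.pi fun _ : Fin S.n => coinLaw S.pgen) := by
  have := isProbabilityMeasure_coinLaw (Set.Ioc_subset_Icc_self h.pcon_mem)
  have := isProbabilityMeasure_coinLaw (Set.Ioc_subset_Icc_self h.pgen_mem)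
  have := isProbabilityMeasure_coinLaw h.q_mem
  have : IsProbabilityMeasure (volume.restrict (Set.Icc (0 : ℝ) 1)) := ⟨by simp⟩
  have hint {β : Type} [MeasurableSpace β] (μ : Measure β) [IsProbabilityMeasure μ]
      (f : β → StepOutcome S.n) (hf : Measurable f) : Integrable (fun b => G (f b)) μ :=
    Integrable.of_bound (hG.comp hf).aestronglyMeasurable C (ae_of_all _ fun b => hC _)
  unfold stepLaw
  rw [integral_prod _ (hint _ (fun x => x) measurable_id),
    integral_coinLaw (Set.Ioc_subset_Icc_self h.pcon_mem)]
  have key (b : Bool) : ∫ y, G (b, y) ∂((Measure.pi fun _ : Fin S.n => coinLaw S.pgen).prod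
      ((coinLaw S.q).prod (volume.restrict (Set.Icc (0 : ℝ) 1)))) =
      ∫ y, (S.q * (∫ u in Set.Icc (0 : ℝ) 1, G (b, y, true, u)) +
        (1 - S.q) * ∫ u in Set.Icc (0 : ℝ) 1, G (b, y, false, u))
          ∂(Measure.pi fun _ : Fin S.n => coinLaw S.pgen) := by
    rw [integral_prod _ (hint _ (fun y => (b, y)) (by fun_prop))]
    refine integral_congr_ae (ae_of_all _ fun y => ?_)
    dsimp only
    rw [integral_prod _ (hint _ (fun z => (b, y, z)) (by fun_prop)), integral_coinLaw h.q_mem]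
  rw [key, key]

theorem IsPhysical.integral_numLinks (h : S.IsPhysical) (f : ℕ → ℝ) :
    ∫ y, f (Finset.univ.filter fun i => y i = true).card
        ∂(Measure.pi fun _ : Fin S.n => coinLaw S.pgen) =
      (1 - S.genProb) * f 0 + S.binomialAvg f := by
  rw [integral_pi_coinLaw (Set.Ioc_subset_Icc_self h.pgen_mem), Finset.range_eq_Ico,
    Finset.sum_eq_sum_Ico_succ_bot (Nat.succ_pos _)]
  have : Finset.Ico (0 + 1) (S.n + 1) = Finset.Icc 1 S.n := by ext; simp
  rw [this]
  simp [binomialAvg, genProb, mul_comm]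

theorem IsPhysical.integral_request (h : S.IsPhysical) :
    ∫ x, (if StepOutcome.request x = true then (1 : ℝ) else 0) ∂S.stepLaw = S.pcon := by
  have := isProbabilityMeasure_coinLaw (Set.Ioc_subset_Icc_self h.pgen_mem)
  have hm : Measurable fun x : StepOutcome S.n =>
      if StepOutcome.request x = true then (1 : ℝ) else 0 :=
    Measurable.ite (StepOutcome.measurable_request (measurableSet_singleton true))
      measurable_const measurable_const
  rw [h.integral_stepLaw (C := 1) hm (fun x => by split_ifs <;> simp)]
  simp [StepOutcome.request]

theorem integral_unitInterval_const (c : ℝ) : ∫ _ in Set.Icc (0 : ℝ) 1, c = c := by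
  simp

theorem IsPhysical.integral_genEvent (h : S.IsPhysical) (c : ℝ) :
    ∫ x, (if 1 ≤ StepOutcome.numLinks x then c else 0) ∂S.stepLaw = S.genProb * c := by
  have hm : Measurable fun x : StepOutcome S.n => if 1 ≤ StepOutcome.numLinks x then c else 0 :=
    Measurable.ite (measurableSet_le measurable_const StepOutcome.measurable_numLinks)
      measurable_const measurable_const
  rw [h.integral_stepLaw (C := |c|) hm (fun x => by split_ifs <;> simp)]
  have e : ∀ b y b' u, (if 1 ≤ StepOutcome.numLinks ((b, y, b', u) : StepOutcome S.n) then c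
      else 0) = (fun k => if 1 ≤ k then c else 0)
        (Finset.univ.filter fun i => y i = true).card := fun _ _ _ _ => rfl
  simp only [e, integral_unitInterval_const, ← add_mul, add_sub_cancel, one_mul]
  have e2 := h.integral_numLinks fun k => if 1 ≤ k then c else 0
  have e3 : S.binomialAvg (fun k => if 1 ≤ k then c else 0) = S.binomialAvg fun _ => c :=
    Finset.sum_congr rfl fun k hk => by simp [(Finset.mem_Icc.1 hk).1]
  rw [e3, binomialAvg_const] at e2
  rw [e2]
  simp only [nonpos_iff_eq_zero, one_ne_zero, if_false]
  ring

theorem IsPhysical.abs_occValue_step_le (h : S.IsPhysical) {F : ℝ} (hF : F ∈ stateSet)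
    (x : StepOutcome S.n) : |S.occValue (S.step F x)| ≤
      max |S.occIntercept| |S.occSlope * (3 / 4) + S.occIntercept| :=
  abs_occValue_le (h.step_mem hF x)

/-- One-step equation for the expected occupation time in an occupied state. -/
theorem IsPhysical.integral_occValue_step (h : S.IsPhysical) {F : ℝ}
    (hF : F ∈ Set.Icc (1 / 4 : ℝ) 1) :
    ∫ x, S.occValue (S.step F x) ∂S.stepLaw = S.occValue F - 1 := by
  have := isProbabilityMeasure_coinLaw (Set.Ioc_subset_Icc_self h.pgen_mem)
  have hF0 := ne_zero_of_mem_Icc hF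
  have hdec := h.decohere_mem hF
  have hm : Measurable fun x => S.occValue (S.step F x) :=
    measurable_occValue.comp (measurable_step.comp (measurable_const.prodMk measurable_id))
  rw [h.integral_stepLaw hm (h.abs_occValue_step_le (Or.inr hF))]
  have htrue : ∀ y b u, S.occValue (S.step F (true, y, b, u)) = 0 := fun y b u => by
    simp [step, hF0, StepOutcome.request, occValue_zero]
  have hfalse : ∀ y u, S.occValue (S.step F (false, y, false, u)) =
      S.occValue (S.decohere F) := fun y u => by
    simp [step, hF0, StepOutcome.request, StepOutcome.purify]
  -- `Φ k` is the expected value after the step, given no request, the choice to purify, and `k` new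
  -- links.
  obtain ⟨Φ, hΦ⟩ : ∃ Φ : ℕ → ℝ, Φ = fun k => if 1 ≤ k then
      (S.occSlope * ((S.policy k).a * (S.decohere F - 1 / 4) + (S.policy k).b) +
        S.occIntercept * ((S.policy k).c * (S.decohere F - 1 / 4) + (S.policy k).d))
      else S.occValue (S.decohere F) := ⟨_, rfl⟩
  have hpur (y : Fin S.n → Bool) :
      ∫ u in Set.Icc (0 : ℝ) 1, S.occValue (S.step F (false, y, true, u)) =
        Φ (Finset.univ.filter fun i => y i = true).card := by
    have hk := StepOutcome.numLinks_le ((false, y, true, 0) : StepOutcome S.n)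
    have hkk : StepOutcome.numLinks ((false, y, true, 0) : StepOutcome S.n) =
      (Finset.univ.filter fun i => y i = true).card := rfl
    rw [hkk] at hk
    have hstep : ∀ u, S.step F (false, y, true, u) =
        if 1 ≤ (Finset.univ.filter fun i => y i = true).card then
          if u < (S.policy (Finset.univ.filter fun i => y i = true).card).successProb
            (S.decohere F) then
          (S.policy (Finset.univ.filter fun i => y i = true).card).jump (S.decohere F) else 0
        else S.decohere F := fun u => by
      simp [step, hF0, StepOutcome.request, StepOutcome.purify, StepOutcome.numLinks,
        StepOutcome.threshold]
    simp only [hstep]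
    generalize (Finset.univ.filter fun i => y i = true).card = k at hk
    simp only [hΦ]
    split_ifs with h1
    · have hadm := h.admissible k (Finset.mem_Icc.2 ⟨h1, hk⟩)
      -- The uniform threshold succeeds with the required probability, and failure contributes
      -- `occValue 0 = 0`.
      rw [← hadm.successProb_mul_affine hdec, ← occValue_of_mem (hadm.jump_mem hdec),
        ← integral_threshold (hadm _ hdec).1]
      refine integral_congr_ae (ae_of_all _ fun u => ?_)
      dsimp only
      split_ifs
      · rfl
      · exact occValue_zero
    · exact integral_unitInterval_const _
  simp only [htrue, hfalse, hpur, integral_unitInterval_const, mul_zero, add_zero, integral_zero,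
    zero_add]
  rw [integral_add .of_finite .of_finite, integral_const_mul, integral_const_mul,
    h.integral_numLinks]
  have e3 : S.binomialAvg Φ = S.binomialAvg fun k =>
        (S.occSlope * ((S.policy k).a * (S.decohere F - 1 / 4) + (S.policy k).b) +
          S.occIntercept * ((S.policy k).c * (S.decohere F - 1 / 4) + (S.policy k).d)) :=
    Finset.sum_congr rfl fun k hk => by simp [hΦ, (Finset.mem_Icc.1 hk).1]
  have e4 : Φ 0 = S.occValue (S.decohere F) := by simp [hΦ]
  rw [e3, e4, binomialAvg_affine, occValue_of_mem hdec, occValue_of_mem hF,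
    h.affine_fixedPoint occSlope_eq h.occIntercept_eq (F - 1 / 4)]
  have hd : S.decohere F - 1 / 4 = Real.exp (-S.Γ) * (F - 1 / 4) := by unfold decohere; ring
  simp only [hd, integral_const, probReal_univ, one_smul]
  ring

theorem IsPhysical.integral_occValue_step_zero (h : S.IsPhysical) :
    ∫ x, S.occValue (S.step 0 x) ∂S.stepLaw = S.genProb * S.occValue S.Fnew := by
  rw [← h.integral_genEvent]
  refine integral_congr_ae (ae_of_all _ fun x => ?_)
  simp only [step, if_true]
  split_ifs
  · rfl
  · exact occValue_zero

end Buffer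

/-! ### Independence of the present outcome from the past -/

section Past

variable {Ω E β : Type*} [MeasurableSpace E] [MeasurableSpace β]

/-- The σ-algebra generated by the terms of the sequence `X` before time `t`. -/
@[reducible] def pastSigma (X : ℕ → Ω → E) (t : ℕ) : MeasurableSpace Ω :=
  ⨆ s ∈ Set.Iio t, MeasurableSpace.comap (X s) inferInstance

variable {X : ℕ → Ω → E}

theorem pastSigma_mono : Monotone (pastSigma X) := fun _ _ hst =>
  biSup_mono fun _ hr => lt_of_lt_of_le hr hst

theorem measurable_pastSigma {s t : ℕ} (hst : s < t) : Measurable[pastSigma X t] (X s) :=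
  Measurable.of_comap_le (le_iSup₂_of_le s hst le_rfl)

theorem pastSigma_le [mΩ : MeasurableSpace Ω] (hX : ∀ t, Measurable (X t)) (t : ℕ) :
    pastSigma X t ≤ mΩ :=
  iSup₂_le fun s _ => (hX s).comap_le

theorem ProbabilityTheory.iIndepFun.indepFun_past [MeasurableSpace Ω] {P : Measure Ω}
    (hindep : iIndepFun X P) (hX : ∀ t, Measurable (X t)) {t : ℕ} {Y : Ω → β}
    (hY : Measurable[pastSigma X t] Y) : IndepFun Y (X t) P := by
  rw [IndepFun_iff_Indep]
  have h := indep_iSup_of_disjoint (fun s => (hX s).comap_le) hindep.iIndep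
    (S := Set.Iio t) (T := {t}) (by simp)
  rw [iSup_singleton] at h
  exact indep_of_indep_of_le_left h hY.comap_le

/-- Integrating out the present outcome, given the past. -/
theorem ProbabilityTheory.iIndepFun.integral_comp_past [MeasurableSpace Ω] {P : Measure Ω}
    [IsProbabilityMeasure P] (hindep : iIndepFun X P) (hX : ∀ t, Measurable (X t)) {t : ℕ}
    {Y : Ω → β} (hY : Measurable[pastSigma X t] Y) {G : β × E → ℝ} (hG : Measurable G) {C : ℝ}
    (hC : ∀ ω, |G (Y ω, X t ω)| ≤ C) :
    ∫ ω, G (Y ω, X t ω) ∂P = ∫ ω, ∫ x, G (Y ω, x) ∂(P.map (X t)) ∂P := by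
  have hY' : Measurable Y := hY.mono (pastSigma_le hX t) le_rfl
  have hYX : Measurable fun ω => (Y ω, X t ω) := hY'.prodMk (hX t)
  have hprod := (indepFun_iff_map_prod_eq_prod_map_map hY'.aemeasurable
    (hX t).aemeasurable).1 (hindep.indepFun_past hX hY)
  have := Measure.isProbabilityMeasure_map (μ := P) hY'.aemeasurable
  have := Measure.isProbabilityMeasure_map (μ := P) (hX t).aemeasurable
  have hint : Integrable G ((P.map Y).prod (P.map (X t))) := by
    rw [← hprod, integrable_map_measure hG.aestronglyMeasurable hYX.aemeasurable]
    exact Integrable.of_bound (hG.comp hYX).aestronglyMeasurable C (ae_of_all _ hC)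
  rw [← integral_map (f := G) hYX.aemeasurable hG.aestronglyMeasurable, hprod,
    integral_prod _ hint, integral_map hY'.aemeasurable]
  exact hG.stronglyMeasurable.integral_prod_right'.aestronglyMeasurable

end Past

/-! ### A strong law for bounded orthogonal variables -/

/-- With `r = Nat.sqrt t`, the distance from `r ^ 2` to `t` is at most `2 * r`, so bounded
increments change `a` by at most `2 * r * C`, which is negligible against `r ^ 2`. -/
theorem tendsto_div_of_tendsto_sq_div {a : ℕ → ℝ} {C : ℝ} (hC : ∀ t, |a (t + 1) - a t| ≤ C)
    (h : Tendsto (fun k : ℕ => a (k ^ 2) / (k : ℝ) ^ 2) atTop (𝓝 0)) :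
    Tendsto (fun t : ℕ => a t / t) atTop (𝓝 0) := by
  have hC0 : 0 ≤ C := (abs_nonneg _).trans (hC 0)
  have hinc : ∀ t s : ℕ, |a (t + s) - a t| ≤ s * C := by
    intro t s
    induction s with
    | zero => simp
    | succ s ih =>
      have e : a (t + (s + 1)) - a t = (a (t + s + 1) - a (t + s)) + (a (t + s) - a t) := by
        rw [← add_assoc]; ring
      rw [e]
      push_cast
      linarith [abs_add_le (a (t + s + 1) - a (t + s)) (a (t + s) - a t), hC (t + s)]
  have hsqrt : Tendsto Nat.sqrt atTop atTop :=
    tendsto_atTop_atTop.2 fun b => ⟨b ^ 2, fun t ht => Nat.le_sqrt'.2 ht⟩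
  have hf : Tendsto (fun k : ℕ => |a (k ^ 2) / (k : ℝ) ^ 2| + 2 * C / k) atTop (𝓝 0) := by
    simpa using h.abs.add (tendsto_const_div_atTop_nhds_zero_nat (2 * C))
  refine squeeze_zero_norm' ?_ (hf.comp hsqrt)
  filter_upwards [eventually_ge_atTop 1] with t ht
  have hr : 1 ≤ Nat.sqrt t := Nat.le_sqrt'.2 (by simpa using ht)
  have h1 : Nat.sqrt t ^ 2 ≤ t := Nat.sqrt_le' t
  have h2 : t < (Nat.sqrt t + 1) ^ 2 := Nat.lt_succ_sqrt' t
  simp only [Function.comp]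
  generalize Nat.sqrt t = r at hr h1 h2
  have hd := hinc (r ^ 2) (t - r ^ 2)
  rw [Nat.add_sub_cancel' h1, Nat.cast_sub h1] at hd
  have hr' : (1 : ℝ) ≤ r := by exact_mod_cast hr
  have h1' : (r : ℝ) ^ 2 ≤ t := by exact_mod_cast h1
  have h2' : (t : ℝ) - r ^ 2 ≤ 2 * r := by
    have : (t : ℝ) + 1 ≤ (r + 1) ^ 2 := by exact_mod_cast h2
    linarith
  push_cast at hd
  have hbd : |a t| ≤ |a (r ^ 2)| + 2 * r * C := by
    have := abs_add_le (a t - a (r ^ 2)) (a (r ^ 2))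
    rw [sub_add_cancel] at this
    have := mul_le_mul_of_nonneg_right h2' hC0
    linarith
  have hr2 : (0 : ℝ) < (r : ℝ) ^ 2 := by positivity
  rw [Real.norm_eq_abs, abs_div, abs_div, Nat.abs_cast, abs_of_pos hr2]
  calc |a t| / t ≤ (|a (r ^ 2)| + 2 * r * C) / (r : ℝ) ^ 2 := by gcongr
    _ = _ := by field_simp

/-- A strong law of large numbers for bounded orthogonal random variables. -/
theorem ae_tendsto_average_of_orthogonal {Ω : Type*} [MeasurableSpace Ω] {P : Measure Ω}
    [IsProbabilityMeasure P] {Z : ℕ → Ω → ℝ} (hm : ∀ t, Measurable (Z t)) {C : ℝ}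
    (hC : ∀ t ω, |Z t ω| ≤ C) (horth : ∀ s t, s < t → ∫ ω, Z s ω * Z t ω ∂P = 0) :
    ∀ᵐ ω ∂P, Tendsto (fun t : ℕ => (∑ s ∈ Finset.range t, Z s ω) / t) atTop (𝓝 0) := by
  have hSm : ∀ t, Measurable fun ω => ∑ s ∈ Finset.range t, Z s ω := fun t =>
    Finset.measurable_sum _ fun s _ => hm s
  have hSb : ∀ t ω, |∑ s ∈ Finset.range t, Z s ω| ≤ t * C := fun t ω => by
    refine (Finset.abs_sum_le_sum_abs _ _).trans ((Finset.sum_le_sum fun s _ => hC s ω).trans ?_)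
    simp
  have hbdd {f : Ω → ℝ} (hf : Measurable f) (D : ℝ) (hD : ∀ ω, |f ω| ≤ D) : Integrable f P :=
    Integrable.of_bound hf.aestronglyMeasurable D (ae_of_all _ hD)
  have hZZ : ∀ s t, Integrable (fun ω => Z s ω * Z t ω) P := fun s t =>
    hbdd ((hm s).mul (hm t)) (C * C) fun ω => by
      rw [abs_mul]
      exact mul_le_mul (hC s ω) (hC t ω) (abs_nonneg _) ((abs_nonneg _).trans (hC s ω))
  have hSq : ∀ t, Integrable (fun ω => (∑ s ∈ Finset.range t, Z s ω) ^ 2) P := fun t =>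
    hbdd ((hSm t).pow_const 2) ((t * C) ^ 2) fun ω => by
      rw [abs_pow]
      exact pow_le_pow_left₀ (abs_nonneg _) (hSb t ω) 2
  -- By orthogonality the cross terms integrate to zero, so second moments add.
  have hvar : ∀ t : ℕ, ∫ ω, (∑ s ∈ Finset.range t, Z s ω) ^ 2 ∂P ≤ t * C ^ 2 := by
    intro t
    induction t with
    | zero => simp
    | succ t ih =>
      have e : ∀ ω, (∑ s ∈ Finset.range (t + 1), Z s ω) ^ 2 =
          (∑ s ∈ Finset.range t, Z s ω) ^ 2 +
            (2 * ∑ s ∈ Finset.range t, Z s ω * Z t ω) + Z t ω * Z t ω := fun ω => by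
        rw [Finset.sum_range_succ, ← Finset.sum_mul]; ring
      have hcross : Integrable (fun ω => 2 * ∑ s ∈ Finset.range t, Z s ω * Z t ω) P :=
        (integrable_finsetSum _ fun s _ => hZZ s t).const_mul 2
      have hfirst : Integrable (fun ω => (∑ s ∈ Finset.range t, Z s ω) ^ 2 +
          2 * ∑ s ∈ Finset.range t, Z s ω * Z t ω) P := (hSq t).add hcross
      simp only [e]
      rw [integral_add hfirst (hZZ t t), integral_add (hSq t) hcross,
        integral_const_mul, integral_finsetSum _ fun s _ => hZZ s t,
        Finset.sum_eq_zero fun s hs => horth s t (Finset.mem_range.1 hs)]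
      have : ∫ ω, Z t ω * Z t ω ∂P ≤ ∫ _, C ^ 2 ∂P := by
        refine integral_mono (hZZ t t) (integrable_const _) fun ω => ?_
        have := hC t ω
        have := abs_nonneg (Z t ω)
        nlinarith [abs_mul_abs_self (Z t ω)]
      simp at this
      push_cast
      linarith
  have hbound : ∀ k : ℕ, ∫⁻ ω, ENNReal.ofReal
      (((∑ s ∈ Finset.range (k ^ 2), Z s ω) / (k : ℝ) ^ 2) ^ 2) ∂P ≤
      ENNReal.ofReal (C ^ 2 * (1 / (k : ℝ) ^ 2)) := by
    intro k
    simp only [div_pow]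
    rw [← ofReal_integral_eq_lintegral_ofReal ((hSq _).div_const _)
      (ae_of_all _ fun ω => by positivity), integral_div]
    refine ENNReal.ofReal_le_ofReal ?_
    rcases Nat.eq_zero_or_pos k with rfl | hk
    · simp
    · have hk' : (0 : ℝ) < k := by exact_mod_cast hk
      have := hvar (k ^ 2)
      push_cast at this
      rw [div_le_iff₀ (by positivity)]
      refine this.trans_eq ?_
      field_simp
  -- Along the squares the second moments of the averages are at most `C ^ 2 / k ^ 2`, hence
  -- summable. So the series of squared averages is almost surely finite and its terms tend to `0`.
  have hsum : ∫⁻ ω, ∑' k : ℕ, ENNReal.ofReal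
      (((∑ s ∈ Finset.range (k ^ 2), Z s ω) / (k : ℝ) ^ 2) ^ 2) ∂P ≠ ∞ := by
    rw [lintegral_tsum fun k =>
      (((hSm _).div_const _).pow_const 2).ennreal_ofReal.aemeasurable]
    refine ne_top_of_le_ne_top ?_ (ENNReal.tsum_le_tsum hbound)
    exact ((Real.summable_one_div_nat_pow.2 one_lt_two).mul_left _).tsum_ofReal_ne_top
  filter_upwards [ae_lt_top (Measurable.tsum fun k =>
    (((hSm _).div_const _).pow_const 2).ennreal_ofReal) hsum] with ω hω
  refine tendsto_div_of_tendsto_sq_div (C := C)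
    (fun t => by rw [Finset.sum_range_succ, add_sub_cancel_left]; exact hC t ω) ?_
  have h0 := ENNReal.tendsto_atTop_zero_of_tsum_ne_top hω.ne
  have h1 := (ENNReal.tendsto_toReal ENNReal.zero_ne_top).comp h0
  simp only [Function.comp_def, ENNReal.toReal_ofReal (sq_nonneg _), ENNReal.toReal_zero] at h1
  have h2 := h1.sqrt
  simp only [Real.sqrt_sq_eq_abs, Real.sqrt_zero] at h2
  exact (tendsto_zero_iff_abs_tendsto_zero _).2 h2

/-! ### Telescoping series and first hitting times -/

theorem summable_of_eq_sub {p u : ℕ → ℝ} {C : ℝ} (hp : ∀ t, 0 ≤ p t) (hu : ∀ t, |u t| ≤ C)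
    (hrec : ∀ t, u (t + 1) = u t - p t) : Summable p := by
  refine summable_of_sum_range_le (c := u 0 + C) hp fun T => ?_
  have : ∑ t ∈ Finset.range T, p t = u 0 - u T := by
    rw [← Finset.sum_range_sub' u T]
    exact Finset.sum_congr rfl fun t _ => by rw [hrec]; ring
  linarith [(abs_le.1 (hu T)).1]

theorem hasSum_of_eq_sub {p u : ℕ → ℝ} (hp : ∀ t, 0 ≤ p t) (hu : Tendsto u atTop (𝓝 0))
    (hrec : ∀ t, u (t + 1) = u t - p t) : HasSum p (u 0) := by
  rw [hasSum_iff_tendsto_nat_of_nonneg hp]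
  have : ∀ T, ∑ t ∈ Finset.range T, p t = u 0 - u T := fun T => by
    rw [← Finset.sum_range_sub' u T]
    exact Finset.sum_congr rfl fun t _ => by rw [hrec]; ring
  simpa [this] using hu.const_sub (u 0)

/-- The tail-sum formula, pathwise: a hitting time counts the times up to which nothing has been
hit. It includes the value `⊤`. -/
theorem ENat.toENNReal_sInf_image_coe (p : ℕ → Prop) [∀ t, Decidable (∀ s ≤ t, ¬p s)] :
    ((sInf ((fun t : ℕ => (t : ℕ∞)) '' {t : ℕ | p t}) : ℕ∞) : ℝ≥0∞) =
      ∑' t, if ∀ s ≤ t, ¬p s then 1 else 0 := by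
  classical
  by_cases h : ∃ n, p n
  · have hinf : sInf ((fun t : ℕ => (t : ℕ∞)) '' {t : ℕ | p t}) = (Nat.find h : ℕ∞) :=
      le_antisymm (sInf_le ⟨_, Nat.find_spec h, rfl⟩) (le_sInf (by
        rintro _ ⟨n, hn, rfl⟩
        exact Nat.cast_le.2 (Nat.find_min' h hn)))
    rw [hinf, tsum_eq_sum (s := Finset.range (Nat.find h)) fun t ht => if_neg fun h1 => ?_]
    · rw [Finset.sum_congr rfl fun t ht => if_pos fun s hs =>
        Nat.find_min h (hs.trans_lt (Finset.mem_range.1 ht))]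
      simp
    · exact h1 _ (not_lt.1 fun h2 => ht (Finset.mem_range.2 h2)) (Nat.find_spec h)
  · push Not at h
    simp [h]

/-! ### Mean occupation and generation times -/

namespace Buffer

variable {S : Buffer} {Ω : Type*} {X : ℕ → Ω → StepOutcome S.n}

theorem measurable_fidelity (t : ℕ) : Measurable[pastSigma X t] (S.fidelity X t) := by
  induction t with
  | zero => exact measurable_const
  | succ t ih =>
    exact measurable_step.comp ((ih.mono (pastSigma_mono t.le_succ) le_rfl).prodMk
      (measurable_pastSigma t.lt_succ_self))

/-- Indicator of the event that the memory is occupied at all times up to `t`. -/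
noncomputable def occInd (S : Buffer) (X : ℕ → Ω → StepOutcome S.n) : ℕ → Ω → ℝ
  | 0, _ => 1
  | t + 1, ω => if S.fidelity X (t + 1) ω = 0 then 0 else occInd S X t ω

/-- Indicator of the event that time `t` belongs to the first empty period of the memory. -/
noncomputable def emptyInd (S : Buffer) (X : ℕ → Ω → StepOutcome S.n) : ℕ → Ω → ℝ
  | 0, _ => 0
  | t + 1, ω =>
    if S.fidelity X (t + 1) ω = 0 then S.occInd X t ω + emptyInd S X t ω else 0

theorem measurable_occInd (t : ℕ) : Measurable[pastSigma X t] (S.occInd X t) := by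
  induction t with
  | zero => exact measurable_const
  | succ t ih =>
    exact Measurable.ite (measurable_fidelity (t + 1) (measurableSet_singleton (0 : ℝ)))
      measurable_const (ih.mono (pastSigma_mono t.le_succ) le_rfl)

theorem measurable_emptyInd (t : ℕ) : Measurable[pastSigma X t] (S.emptyInd X t) := by
  induction t with
  | zero => exact measurable_const
  | succ t ih =>
    exact Measurable.ite (measurable_fidelity (t + 1) (measurableSet_singleton (0 : ℝ)))
      (((measurable_occInd t).mono (pastSigma_mono t.le_succ) le_rfl).add
        (ih.mono (pastSigma_mono t.le_succ) le_rfl)) measurable_const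

/-- The sum of the two indicators marks the event that the first cycle (occupied, then empty) has
not ended by time `t`. -/
theorem occInd_emptyInd_mem (t : ℕ) (ω : Ω) :
    0 ≤ S.occInd X t ω ∧ 0 ≤ S.emptyInd X t ω ∧ S.occInd X t ω + S.emptyInd X t ω ≤ 1 := by
  induction t with
  | zero => simp [occInd, emptyInd]
  | succ t ih =>
    obtain ⟨h1, h2, h3⟩ := ih
    simp only [occInd, emptyInd]
    split_ifs
    · exact ⟨le_rfl, by linarith, by linarith⟩
    · exact ⟨h1, le_rfl, by linarith⟩

theorem abs_occInd_le (t : ℕ) (ω : Ω) : |S.occInd X t ω| ≤ 1 := by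
  obtain ⟨h1, h2, h3⟩ := S.occInd_emptyInd_mem (X := X) t ω
  rw [abs_of_nonneg h1]; linarith

theorem abs_emptyInd_le (t : ℕ) (ω : Ω) : |S.emptyInd X t ω| ≤ 1 := by
  obtain ⟨h1, h2, h3⟩ := S.occInd_emptyInd_mem (X := X) t ω
  rw [abs_of_nonneg h2]; linarith

open Classical in
theorem IsPhysical.occInd_eq (h : S.IsPhysical) (t : ℕ) (ω : Ω) :
    S.occInd X t ω = if ∀ s ≤ t, ¬S.fidelity X s ω = 0 then 1 else 0 := by
  induction t with
  | zero =>
    have : S.fidelity X 0 ω ≠ 0 := ne_zero_of_mem_Icc h.Fnew_mem_Icc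
    simp [occInd, this]
  | succ t ih =>
    simp only [occInd, Nat.le_succ_iff, or_imp, forall_and, forall_eq, ih]
    by_cases h1 : S.fidelity X (t + 1) ω = 0 <;> simp [h1]

theorem IsPhysical.fidelity_ne_zero_of_occInd (h : S.IsPhysical) {t : ℕ} {ω : Ω}
    (hocc : S.occInd X t ω ≠ 0) : S.fidelity X t ω ≠ 0 := by
  rw [h.occInd_eq] at hocc
  exact (ite_ne_right_iff.1 hocc).1 t le_rfl

theorem fidelity_eq_zero_of_emptyInd {t : ℕ} {ω : Ω} (hemp : S.emptyInd X t ω ≠ 0) :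
    S.fidelity X t ω = 0 := by
  cases t with
  | zero => exact absurd rfl hemp
  | succ t => exact (ite_ne_right_iff.1 hemp).1

theorem IsPhysical.occTime_eq_tsum (h : S.IsPhysical) (ω : Ω) :
    ((S.occTime X ω : ℕ∞) : ℝ≥0∞) = ∑' t, ENNReal.ofReal (S.occInd X t ω) := by
  classical
  rw [occTime, ENat.toENNReal_sInf_image_coe fun t => S.fidelity X t ω = 0]
  refine tsum_congr fun t => ?_
  rw [h.occInd_eq]
  split_ifs <;> simp

/-- Finiteness matters: `toNat` sends `⊤` to `0`, where `genTime` would lose its meaning. With `τ`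
the emptying time, `emptyInd` vanishes before `τ`, and from `τ` on it marks the times before a new
link appears. -/
theorem IsPhysical.genTime_eq_tsum (h : S.IsPhysical) {ω : Ω} (hfin : S.occTime X ω ≠ ⊤) :
    ((S.genTime X ω : ℕ∞) : ℝ≥0∞) = ∑' t, ENNReal.ofReal (S.emptyInd X t ω) := by
  classical
  have hne : ((fun t : ℕ => (t : ℕ∞)) '' {t : ℕ | S.fidelity X t ω = 0}).Nonempty := by
    by_contra h0
    exact hfin (by rw [occTime, Set.not_nonempty_iff_eq_empty.1 h0, sInf_empty])
  obtain ⟨τ, hτ0, hτ⟩ := csInf_mem hne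
  have hocc : S.occTime X ω = (τ : ℕ∞) := hτ.symm
  have hlt : ∀ s < τ, S.fidelity X s ω ≠ 0 := fun s hs h0 => by
    have : (τ : ℕ∞) ≤ s := hocc ▸ sInf_le ⟨s, h0, rfl⟩
    exact absurd (Nat.cast_le.1 this) (not_le.2 hs)
  have hpos : τ ≠ 0 := by
    rintro rfl
    exact ne_zero_of_mem_Icc h.Fnew_mem_Icc hτ0
  have hbefore : ∀ s < τ, S.emptyInd X s ω = 0 := fun s hs => by
    by_contra h0
    exact hlt s hs (fidelity_eq_zero_of_emptyInd h0)
  have hafter : ∀ s, S.occInd X (τ + s) ω = 0 := fun s => by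
    rw [h.occInd_eq, if_neg fun h1 => h1 τ (Nat.le_add_right _ _) hτ0]
  have hemp : ∀ s, S.emptyInd X (s + τ) ω =
      if ∀ r ≤ s, ¬0 < S.fidelity X (τ + r) ω then 1 else 0 := by
    intro s
    induction s with
    | zero =>
      obtain ⟨r, rfl⟩ := Nat.exists_eq_succ_of_ne_zero hpos
      have h1 : S.fidelity X (r + 1) ω = 0 := hτ0
      have h2 : S.occInd X r ω = 1 := by
        rw [h.occInd_eq, if_pos fun s hs => hlt s (Nat.lt_succ_of_le hs)]
      simp [emptyInd, h1, h2, hbefore r r.lt_succ_self]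
    | succ s ih =>
      have e : s + 1 + τ = s + τ + 1 := by omega
      have e2 : τ + (s + 1) = s + τ + 1 := by omega
      have e3 := hafter s
      rw [add_comm] at e3
      simp only [Nat.le_succ_iff, or_imp, forall_and, forall_eq]
      have hpos_iff := pos_iff_of_mem_stateSet (h.fidelity_mem X (s + τ + 1) ω)
      rw [e, e2, emptyInd, ih, e3]
      by_cases h1 : S.fidelity X (s + τ + 1) ω = 0
      · simp [h1]
      · simp [h1, hpos_iff.2 h1]
  rw [genTime, hocc, ENat.toNat_natCast,
    ENat.toENNReal_sInf_image_coe fun s => 0 < S.fidelity X (τ + s) ω,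
    ← (ENNReal.summable (f := fun s =>
      ENNReal.ofReal (S.emptyInd X (s + τ) ω))).sum_add_tsum_nat_add'
        (f := fun s => ENNReal.ofReal (S.emptyInd X s ω)),
    Finset.sum_eq_zero fun s hs => by rw [hbefore s (Finset.mem_range.1 hs), ENNReal.ofReal_zero],
    zero_add]
  refine tsum_congr fun s => ?_
  rw [hemp]
  split_ifs <;> simp

variable [MeasurableSpace Ω] {P : Measure Ω} [IsProbabilityMeasure P]

/-- Integrating out the outcomes of the present time step, given the past. -/
theorem IsPhysical.integral_mul_step (h : S.IsPhysical) (hX : ∀ t, Measurable (X t))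
    (hindep : iIndepFun X P) (hlaw : ∀ t, P.map (X t) = S.stepLaw) {t : ℕ} {φ : Ω → ℝ}
    (hφ : Measurable[pastSigma X t] φ) {C : ℝ} (hC : ∀ ω, |φ ω| ≤ C)
    {g : ℝ × StepOutcome S.n → ℝ} (hg : Measurable g) {D : ℝ}
    (hD : ∀ F ∈ stateSet, ∀ x, |g (F, x)| ≤ D) :
    ∫ ω, φ ω * g (S.fidelity X t ω, X t ω) ∂P =
      ∫ ω, φ ω * ∫ x, g (S.fidelity X t ω, x) ∂S.stepLaw ∂P := by
  have e := hindep.integral_comp_past hX (Y := fun ω => (φ ω, S.fidelity X t ω))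
    (hφ.prodMk (measurable_fidelity t)) (G := fun z => z.1.1 * g (z.1.2, z.2)) (by fun_prop)
    (C := C * D) (fun ω => by
      rw [abs_mul]
      exact mul_le_mul (hC ω) (hD _ (h.fidelity_mem X t ω) _) (abs_nonneg _)
        ((abs_nonneg _).trans (hC ω)))
  simpa only [hlaw, integral_const_mul] using e

theorem lintegral_tsum_ofReal {f : ℕ → Ω → ℝ} (hm : ∀ t, Measurable (f t))
    (h0 : ∀ t ω, 0 ≤ f t ω) (h1 : ∀ t ω, |f t ω| ≤ 1) {c : ℝ}
    (hsum : HasSum (fun t => ∫ ω, f t ω ∂P) c) :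
    ∫⁻ ω, ∑' t, ENNReal.ofReal (f t ω) ∂P = ENNReal.ofReal c := by
  rw [lintegral_tsum fun t => (hm t).ennreal_ofReal.aemeasurable]
  have : ∀ t, ∫⁻ ω, ENNReal.ofReal (f t ω) ∂P = ENNReal.ofReal (∫ ω, f t ω ∂P) := fun t =>
    (ofReal_integral_eq_lintegral_ofReal
      (Integrable.of_bound (hm t).aestronglyMeasurable 1 (ae_of_all _ (h1 t)))
      (ae_of_all _ (h0 t))).symm
  simp only [this]
  rw [← ENNReal.ofReal_tsum_of_nonneg (fun t => integral_nonneg (h0 t)) hsum.summable,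
    hsum.tsum_eq]

/-- Let `p t` be the probability of being occupied up to `t`, and `u t` the expectation of
`occValue` on that event. The one-step equation gives `u (t + 1) = u t - p t`. Boundedness of `u`
makes `p` summable; then `|u t| ≤ M * p t` forces `u → 0`, and the sum is `u 0`. -/
theorem IsPhysical.hasSum_integral_occInd (h : S.IsPhysical) (hX : ∀ t, Measurable (X t))
    (hindep : iIndepFun X P) (hlaw : ∀ t, P.map (X t) = S.stepLaw) :
    HasSum (fun t => ∫ ω, S.occInd X t ω ∂P) (S.occValue S.Fnew) := by
  set M := max |S.occIntercept| |S.occSlope * (3 / 4) + S.occIntercept|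
  have hmF (t : ℕ) : Measurable (S.fidelity X t) :=
    (measurable_fidelity t).mono (pastSigma_le hX t) le_rfl
  have hmo (t : ℕ) : Measurable (S.occInd X t) :=
    (measurable_occInd t).mono (pastSigma_le hX t) le_rfl
  have hio (t : ℕ) : Integrable (S.occInd X t) P :=
    Integrable.of_bound (hmo t).aestronglyMeasurable 1 (ae_of_all _ (abs_occInd_le t))
  have hb (t : ℕ) (ω : Ω) : |S.occInd X t ω * S.occValue (S.fidelity X t ω)| ≤
      M * S.occInd X t ω := by
    have h0 := (S.occInd_emptyInd_mem (X := X) t ω).1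
    rw [abs_mul, abs_of_nonneg h0, mul_comm]
    exact mul_le_mul_of_nonneg_right (abs_occValue_le (h.fidelity_mem X t ω)) h0
  have hM0 : 0 ≤ M := (abs_nonneg _).trans (le_max_left _ _)
  have hiu (t : ℕ) : Integrable (fun ω => S.occInd X t ω * S.occValue (S.fidelity X t ω)) P :=
    ((hio t).const_mul M).mono' ((hmo t).mul
      (measurable_occValue.comp (hmF t))).aestronglyMeasurable (ae_of_all _ (hb t))
  have hp0 (t : ℕ) : 0 ≤ ∫ ω, S.occInd X t ω ∂P :=
    integral_nonneg fun ω => (S.occInd_emptyInd_mem t ω).1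
  have hp1 (t : ℕ) : ∫ ω, S.occInd X t ω ∂P ≤ 1 := by
    have := integral_mono (hio t) (integrable_const (1 : ℝ))
      fun ω => (le_abs_self _).trans (abs_occInd_le t ω)
    simpa using this
  have hu (t : ℕ) : |∫ ω, S.occInd X t ω * S.occValue (S.fidelity X t ω) ∂P| ≤
      M * ∫ ω, S.occInd X t ω ∂P := by
    rw [← integral_const_mul]
    exact (abs_integral_le_integral_abs).trans
      (integral_mono (hiu t).abs ((hio t).const_mul M) (hb t))
  have hrec (t : ℕ) : ∫ ω, S.occInd X (t + 1) ω * S.occValue (S.fidelity X (t + 1) ω) ∂P =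
      ∫ ω, S.occInd X t ω * S.occValue (S.fidelity X t ω) ∂P - ∫ ω, S.occInd X t ω ∂P := by
    rw [← integral_sub (hiu t) (hio t)]
    -- Since `occValue 0 = 0`, the indicator at `t + 1` may be replaced by the one at `t`, which is
    -- measurable with respect to the past.
    have e1 : ∀ ω, S.occInd X (t + 1) ω * S.occValue (S.fidelity X (t + 1) ω) =
        S.occInd X t ω * S.occValue (S.step (S.fidelity X t ω) (X t ω)) := fun ω => by
      have : S.step (S.fidelity X t ω) (X t ω) = S.fidelity X (t + 1) ω := rfl
      rw [this, occInd]
      split_ifs with h0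
      · rw [h0, occValue_zero]; simp
      · rfl
    simp only [e1]
    rw [h.integral_mul_step hX hindep hlaw (measurable_occInd t) (abs_occInd_le t)
      (g := fun z => S.occValue (S.step z.1 z.2)) (measurable_occValue.comp measurable_step)
      fun F hF x => h.abs_occValue_step_le hF x]
    refine integral_congr_ae (ae_of_all _ fun ω => ?_)
    dsimp only
    by_cases h0 : S.occInd X t ω = 0
    · simp [h0]
    · rw [h.integral_occValue_step ((h.fidelity_mem X t ω).resolve_left
        (h.fidelity_ne_zero_of_occInd h0))]
      ring
  have hsum := summable_of_eq_sub hp0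
    (fun t => (hu t).trans (mul_le_of_le_one_right hM0 (hp1 t))) hrec
  have hlim := hasSum_of_eq_sub hp0 (squeeze_zero_norm hu
    (by simpa using hsum.tendsto_atTop_zero.const_mul M)) hrec
  simpa [occInd, fidelity] using hlim

/-- The probability that the first cycle is unfinished drops at each step by `genProb` times the
probability of being in the first empty period. It starts at `1` and tends to `0`, so the drops sum
to `1`. -/
theorem IsPhysical.hasSum_integral_emptyInd (h : S.IsPhysical) (hX : ∀ t, Measurable (X t))
    (hindep : iIndepFun X P) (hlaw : ∀ t, P.map (X t) = S.stepLaw) :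
    HasSum (fun t => ∫ ω, S.emptyInd X t ω ∂P) (1 / S.genProb) := by
  have hmo (t : ℕ) : Measurable (S.occInd X t) :=
    (measurable_occInd t).mono (pastSigma_le hX t) le_rfl
  have hme (t : ℕ) : Measurable (S.emptyInd X t) :=
    (measurable_emptyInd t).mono (pastSigma_le hX t) le_rfl
  have hio (t : ℕ) : Integrable (S.occInd X t) P :=
    Integrable.of_bound (hmo t).aestronglyMeasurable 1 (ae_of_all _ (abs_occInd_le t))
  have hie (t : ℕ) : Integrable (S.emptyInd X t) P :=
    Integrable.of_bound (hme t).aestronglyMeasurable 1 (ae_of_all _ (abs_emptyInd_le t))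
  have hg := h.genProb_pos
  have hp0 (t : ℕ) : 0 ≤ S.genProb * ∫ ω, S.emptyInd X t ω ∂P :=
    mul_nonneg hg.le (integral_nonneg fun ω => (S.occInd_emptyInd_mem t ω).2.1)
  have hind : Measurable fun z : ℝ × StepOutcome S.n =>
      if 1 ≤ z.2.numLinks then (1 : ℝ) else 0 :=
    Measurable.ite (measurableSet_le measurable_const
      (StepOutcome.measurable_numLinks.comp measurable_snd)) measurable_const measurable_const
  have hig (t : ℕ) : Integrable (fun ω =>
      S.emptyInd X t ω * if 1 ≤ (X t ω).numLinks then 1 else 0) P :=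
    (hie t).norm.mono' ((hme t).mul (hind.comp
      (measurable_const (a := (0 : ℝ)) |>.prodMk (hX t)))).aestronglyMeasurable
      (ae_of_all _ fun ω => by split_ifs <;> simp)
  have hrec (t : ℕ) : ∫ ω, S.occInd X (t + 1) ω + S.emptyInd X (t + 1) ω ∂P =
      ∫ ω, S.occInd X t ω + S.emptyInd X t ω ∂P -
        S.genProb * ∫ ω, S.emptyInd X t ω ∂P := by
    have e1 : ∀ ω, S.occInd X (t + 1) ω + S.emptyInd X (t + 1) ω =
        (S.occInd X t ω + S.emptyInd X t ω) -
          S.emptyInd X t ω * if 1 ≤ (X t ω).numLinks then 1 else 0 := fun ω => by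
      have hs : S.fidelity X (t + 1) ω = S.step (S.fidelity X t ω) (X t ω) := rfl
      simp only [occInd, emptyInd]
      by_cases h0 : S.emptyInd X t ω = 0
      · rw [h0]; split_ifs <;> ring
      · rw [hs, fidelity_eq_zero_of_emptyInd h0, step, if_pos rfl]
        have := ne_zero_of_mem_Icc h.Fnew_mem_Icc
        by_cases h1 : 1 ≤ (X t ω).numLinks <;> simp [h1, this]
    have e2 := h.integral_mul_step hX hindep hlaw (measurable_emptyInd t) (abs_emptyInd_le t)
      (g := fun z => if 1 ≤ z.2.numLinks then 1 else 0) hind (D := 1)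
      fun F hF x => by dsimp only; split_ifs <;> simp
    simp only [h.integral_genEvent, mul_one, integral_mul_const] at e2
    simp only [e1]
    have hadd : Integrable (fun ω => S.occInd X t ω + S.emptyInd X t ω) P := (hio t).add (hie t)
    rw [integral_sub hadd (hig t), e2]
    ring
  have hu (t : ℕ) : |∫ ω, S.occInd X t ω + S.emptyInd X t ω ∂P| ≤ 2 := by
    rw [integral_add (hio t) (hie t)]
    have h1 := integral_mono (hio t) (integrable_const (1 : ℝ))
      fun ω => (le_abs_self _).trans (abs_occInd_le t ω)
    have h2 := integral_mono (hie t) (integrable_const (1 : ℝ))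
      fun ω => (le_abs_self _).trans (abs_emptyInd_le t ω)
    have h3 : 0 ≤ ∫ ω, S.occInd X t ω ∂P :=
      integral_nonneg fun ω => (S.occInd_emptyInd_mem t ω).1
    have h4 : 0 ≤ ∫ ω, S.emptyInd X t ω ∂P :=
      integral_nonneg fun ω => (S.occInd_emptyInd_mem t ω).2.1
    simp only [integral_const, probReal_univ, one_smul] at h1 h2
    rw [abs_le]
    constructor <;> linarith
  have hsum := summable_of_eq_sub hp0 hu hrec
  have hsum' : Summable fun t => ∫ ω, S.emptyInd X t ω ∂P := by
    simpa [hg.ne'] using hsum.mul_left S.genProb⁻¹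
  have hlim := hasSum_of_eq_sub (u := fun t => ∫ ω, S.occInd X t ω + S.emptyInd X t ω ∂P) hp0 (by
    simpa [integral_add (hio _) (hie _)] using
      (h.hasSum_integral_occInd hX hindep hlaw).summable.tendsto_atTop_zero.add
        hsum'.tendsto_atTop_zero) hrec
  have := hlim.mul_left S.genProb⁻¹
  simpa [occInd, emptyInd, hg.ne'] using this

theorem IsPhysical.meanOccTime_eq (h : S.IsPhysical) (hX : ∀ t, Measurable (X t))
    (hindep : iIndepFun X P) (hlaw : ∀ t, P.map (X t) = S.stepLaw) :
    S.meanOccTime X P = ENNReal.ofReal (S.occValue S.Fnew) := by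
  simp only [meanOccTime, h.occTime_eq_tsum]
  exact lintegral_tsum_ofReal
    (fun t => (measurable_occInd t).mono (pastSigma_le hX t) le_rfl)
    (fun t ω => (S.occInd_emptyInd_mem t ω).1) abs_occInd_le
    (h.hasSum_integral_occInd hX hindep hlaw)

/-- The sign is read off the series of probabilities rather than the closed form; it ensures that
`ENNReal.ofReal` does not truncate. -/
theorem IsPhysical.occValue_Fnew_nonneg (h : S.IsPhysical) (hX : ∀ t, Measurable (X t))
    (hindep : iIndepFun X P) (hlaw : ∀ t, P.map (X t) = S.stepLaw) :
    0 ≤ S.occValue S.Fnew :=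
  (h.hasSum_integral_occInd hX hindep hlaw).nonneg fun t =>
    integral_nonneg fun ω => (S.occInd_emptyInd_mem t ω).1

theorem IsPhysical.ae_occTime_ne_top (h : S.IsPhysical) (hX : ∀ t, Measurable (X t))
    (hindep : iIndepFun X P) (hlaw : ∀ t, P.map (X t) = S.stepLaw) :
    ∀ᵐ ω ∂P, S.occTime X ω ≠ ⊤ := by
  have hfin := h.meanOccTime_eq hX hindep hlaw
  simp only [meanOccTime, h.occTime_eq_tsum] at hfin
  filter_upwards [ae_lt_top (Measurable.tsum fun t =>
    ((measurable_occInd t).mono (pastSigma_le hX t) le_rfl).ennreal_ofReal)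
    (hfin.trans_ne ENNReal.ofReal_ne_top)] with ω hω htop
  rw [← h.occTime_eq_tsum, htop] at hω
  simp at hω

theorem IsPhysical.meanGenTime_eq (h : S.IsPhysical) (hX : ∀ t, Measurable (X t))
    (hindep : iIndepFun X P) (hlaw : ∀ t, P.map (X t) = S.stepLaw) :
    S.meanGenTime X P = ENNReal.ofReal (1 / S.genProb) := by
  rw [← lintegral_tsum_ofReal
    (fun t => (measurable_emptyInd t).mono (pastSigma_le hX t) le_rfl)
    (fun t ω => (S.occInd_emptyInd_mem t ω).2.1) abs_emptyInd_le
    (h.hasSum_integral_emptyInd hX hindep hlaw)]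
  refine lintegral_congr_ae ?_
  filter_upwards [h.ae_occTime_ne_top hX hindep hlaw] with ω hω
  exact h.genTime_eq_tsum hω

end Buffer

/-! ### From time averages to averages over requests -/

theorem infinite_of_tendsto_average {p : ℕ → Prop} [DecidablePred p] {c : ℝ} (hc : 0 < c)
    (hp : Tendsto (fun T : ℕ => (∑ t ∈ Finset.range T, if p t then (1 : ℝ) else 0) / T) atTop
      (𝓝 c)) : {t | p t}.Infinite := by
  intro hfin
  have hs : Summable fun t => if p t then (1 : ℝ) else 0 :=
    summable_of_hasFiniteSupport (hfin.subset fun t ht => by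
      by_contra h
      exact ht (if_neg h))
  exact hc.ne' (tendsto_nhds_unique hp
    (hs.hasSum.tendsto_sum_nat.div_atTop tendsto_natCast_atTop_atTop))

theorem sum_range_nth {p : ℕ → Prop} [DecidablePred p] (hp : {t | p t}.Infinite) (f : ℕ → ℝ)
    (m : ℕ) : ∑ j ∈ Finset.range m, f (Nat.nth p j) =
      ∑ t ∈ Finset.range (Nat.nth p m), if p t then f t else 0 := by
  induction m with
  | zero =>
    rw [← Finset.sum_filter, Finset.filter_false_of_mem]
    · simp
    · intro t ht hpt
      exact (Finset.mem_range.1 ht).not_ge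
        ((Nat.nth_monotone hp (Nat.zero_le _)).trans_eq (Nat.nth_count hpt))
  | succ m ih =>
    rw [Finset.sum_range_succ, ih, ← Finset.sum_filter, ← Finset.sum_filter,
      Nat.filter_range_nth_eq_insert_of_infinite hp, Finset.sum_insert (by simp), add_comm]

/-- If the times in `p` have density `c > 0` and the sums of `f - a` over them are negligible,
then the averages of `f` over the first `m` times in `p` tend to `a`. -/
theorem tendsto_average_nth {p : ℕ → Prop} [DecidablePred p] {f : ℕ → ℝ} {c a : ℝ} (hc : 0 < c)
    (hp : Tendsto (fun T : ℕ => (∑ t ∈ Finset.range T, if p t then (1 : ℝ) else 0) / T) atTop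
      (𝓝 c))
    (hf : Tendsto (fun T : ℕ => (∑ t ∈ Finset.range T, if p t then f t - a else 0) / T) atTop
      (𝓝 0)) :
    Tendsto (fun m : ℕ => (1 / (m : ℝ)) * ∑ j ∈ Finset.range m, f (Nat.nth p j)) atTop
      (𝓝 a) := by
  have hinf := infinite_of_tendsto_average hc hp
  have hmono := Nat.nth_strictMono hinf
  -- Both averages are evaluated at `T = Nat.nth p m`, before which exactly `m` times lie in `p`;
  -- the factors `1 / T` cancel in the quotient.
  have hlim := (hf.comp hmono.tendsto_atTop).div (hp.comp hmono.tendsto_atTop) hc.ne'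
  rw [zero_div] at hlim
  have hlim' := hlim.add_const a
  rw [zero_add] at hlim'
  refine hlim'.congr' ?_
  filter_upwards [eventually_ge_atTop 1] with m hm
  have hm' : (m : ℝ) ≠ 0 := by positivity
  have hT : ((Nat.nth p m : ℕ) : ℝ) ≠ 0 := by
    exact Nat.cast_ne_zero.2 (Nat.one_le_iff_ne_zero.1 (hm.trans (hmono.id_le m)))
  simp only [Pi.div_apply, Function.comp]
  rw [← sum_range_nth hinf (fun t => f t - a), ← sum_range_nth hinf (fun _ => 1)]
  simp only [Finset.sum_sub_distrib, Finset.sum_const, Finset.card_range, nsmul_eq_mul, mul_one]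
  field_simp
  ring

/-! ### The availability -/

namespace Buffer

variable {S : Buffer} {Ω : Type*} {X : ℕ → Ω → StepOutcome S.n}
variable [MeasurableSpace Ω] {P : Measure Ω} [IsProbabilityMeasure P]

/-- Law of large numbers for a function of the state and of the outcomes of a time step that has
mean zero in every state. -/
theorem IsPhysical.ae_tendsto_average_step (h : S.IsPhysical) (hX : ∀ t, Measurable (X t))
    (hindep : iIndepFun X P) (hlaw : ∀ t, P.map (X t) = S.stepLaw)
    {g : ℝ × StepOutcome S.n → ℝ} (hg : Measurable g) {D : ℝ}
    (hD : ∀ F ∈ stateSet, ∀ x, |g (F, x)| ≤ D)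
    (hzero : ∀ F ∈ stateSet, ∫ x, g (F, x) ∂S.stepLaw = 0) :
    ∀ᵐ ω ∂P, Tendsto (fun T : ℕ =>
      (∑ t ∈ Finset.range T, g (S.fidelity X t ω, X t ω)) / T) atTop (𝓝 0) := by
  have hpast {s t : ℕ} (hst : s < t) :
      Measurable[pastSigma X t] fun ω => g (S.fidelity X s ω, X s ω) :=
    hg.comp (((measurable_fidelity s).mono (pastSigma_mono hst.le) le_rfl).prodMk
      (measurable_pastSigma hst))
  refine ae_tendsto_average_of_orthogonal (C := D)
    (fun t => (hpast t.lt_succ_self).mono (pastSigma_le hX _) le_rfl)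
    (fun t ω => hD _ (h.fidelity_mem X t ω) _) fun s t hst => ?_
  rw [h.integral_mul_step hX hindep hlaw (hpast hst)
    (fun ω => hD _ (h.fidelity_mem X s ω) _) hg hD]
  simp [hzero _ (h.fidelity_mem X t _)]

theorem IsPhysical.ae_hasAvailability (h : S.IsPhysical) (hX : ∀ t, Measurable (X t))
    (hindep : iIndepFun X P) (hlaw : ∀ t, P.map (X t) = S.stepLaw) :
    ∀ᵐ ω ∂P, S.HasAvailability X ω
      (S.occValue S.Fnew / (1 / S.genProb + S.occValue S.Fnew)) := by
  have := h.isProbabilityMeasure_stepLaw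
  have hg := h.genProb_pos
  have hV := h.occValue_Fnew_nonneg hX hindep hlaw
  have hp := h.pcon_mem.1
  set a := S.occValue S.Fnew / (1 / S.genProb + S.occValue S.Fnew) with ha
  -- The balance equation that makes the summand in `hlim2` centred in the empty state.
  have ha' : (1 - a) * (S.genProb * S.occValue S.Fnew) = a := by
    have : 0 < 1 + S.genProb * S.occValue S.Fnew := by positivity
    rw [ha]
    field_simp
    ring
  obtain ⟨M, hM⟩ : ∃ M, ∀ F ∈ stateSet, |S.occValue F| ≤ M := ⟨_, fun F hF => abs_occValue_le hF⟩
  have hreq : Measurable fun x : StepOutcome S.n =>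
      if StepOutcome.request x = true then (1 : ℝ) else 0 :=
    Measurable.ite (StepOutcome.measurable_request (measurableSet_singleton true))
      measurable_const measurable_const
  have hocc : Measurable fun F : ℝ => if F ≠ 0 then (1 : ℝ) else 0 :=
    Measurable.ite (measurableSet_singleton (0 : ℝ)).compl measurable_const measurable_const
  have hV' := measurable_occValue (S := S)
  have hstep := measurable_step (S := S)
  have hreq_le (x : StepOutcome S.n) :
      |if StepOutcome.request x = true then (1 : ℝ) else 0| ≤ 1 := by split_ifs <;> simp
  have hreq_int : Integrable (fun x : StepOutcome S.n =>
      if StepOutcome.request x = true then (1 : ℝ) else 0) S.stepLaw :=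
    Integrable.of_bound hreq.aestronglyMeasurable 1 (ae_of_all _ hreq_le)
  have hVint {F : ℝ} (hF : F ∈ stateSet) :
      Integrable (fun x => S.occValue (S.step F x)) S.stepLaw :=
    Integrable.of_bound (hV'.comp (hstep.comp
      (measurable_const.prodMk measurable_id))).aestronglyMeasurable M
      (ae_of_all _ fun x => hM _ (h.step_mem hF x))
  have hlim1 := h.ae_tendsto_average_step hX hindep hlaw
    (g := fun z => (if StepOutcome.request z.2 = true then 1 else 0) - S.pcon)
    ((hreq.comp measurable_snd).sub_const _) (D := 1 + |S.pcon|)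
    (fun F _ x => (abs_sub _ _).trans (add_le_add_left (hreq_le x) _))
    (fun F _ => by
      rw [integral_sub hreq_int (integrable_const _), h.integral_request]
      simp)
  -- In an occupied state the first term has mean `pcon * (1 - a)` and `occValue` drops by `1` on
  -- average, so the factor `pcon * (1 - a)` makes the means cancel. In the empty state the means
  -- are `-pcon * a` and `pcon * (1 - a) * genProb * occValue Fnew`, which cancel by `ha'`.
  have hlim2 := h.ae_tendsto_average_step hX hindep hlaw
    (g := fun z => (if StepOutcome.request z.2 = true then 1 else 0) *
      ((if z.1 ≠ 0 then 1 else 0) - a) +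
      S.pcon * (1 - a) * (S.occValue (S.step z.1 z.2) - S.occValue z.1))
    (((hreq.comp measurable_snd).mul ((hocc.comp measurable_fst).sub_const a)).add
      (((hV'.comp hstep).sub (hV'.comp measurable_fst)).const_mul _))
    (D := 1 * (1 + |a|) + |S.pcon * (1 - a)| * (M + M))
    (fun F hF x => by
      refine (abs_add_le _ _).trans (add_le_add ?_ ?_)
      · rw [abs_mul]
        refine mul_le_mul (hreq_le x) ((abs_sub _ _).trans ?_) (abs_nonneg _) zero_le_one
        gcongr
        split_ifs <;> simp
      · rw [abs_mul]
        gcongr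
        exact (abs_sub _ _).trans (add_le_add (hM _ (h.step_mem hF x)) (hM _ hF)))
    (fun F hF => by
      have hdiff : Integrable (fun x => S.occValue (S.step F x) - S.occValue F) S.stepLaw :=
        (hVint hF).sub (integrable_const _)
      refine (integral_add (hreq_int.mul_const ((if F ≠ 0 then 1 else 0) - a))
        (hdiff.const_mul (S.pcon * (1 - a)))).trans ?_
      rw [integral_mul_const, integral_const_mul, integral_sub (hVint hF) (integrable_const _),
        h.integral_request]
      rcases hF with rfl | hF
      · rw [h.integral_occValue_step_zero]
        simp [occValue_zero]
        linear_combination S.pcon * ha'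
      · rw [h.integral_occValue_step hF]
        simp [ne_zero_of_mem_Icc hF])
  filter_upwards [hlim1, hlim2] with ω h1 h2
  have hcount : Tendsto (fun T : ℕ => (∑ t ∈ Finset.range T,
      if (X t ω).request = true then (1 : ℝ) else 0) / T) atTop (𝓝 S.pcon) := by
    have := h1.add_const S.pcon
    rw [zero_add] at this
    refine this.congr' ?_
    filter_upwards [eventually_ge_atTop 1] with T hT
    have hT' : (T : ℝ) ≠ 0 := by positivity
    simp only [Finset.sum_sub_distrib, Finset.sum_const, Finset.card_range, nsmul_eq_mul]
    field_simp
    ring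
  have hserved : Tendsto (fun T : ℕ => (∑ t ∈ Finset.range T,
      if (X t ω).request = true then (if S.fidelity X t ω ≠ 0 then (1 : ℝ) else 0) - a else 0)
        / T) atTop (𝓝 0) := by
    -- The increments of `occValue` telescope to a bounded quantity, negligible after division by
    -- `T`.
    have hbd : Tendsto (fun T : ℕ => S.pcon * (1 - a) *
        (S.occValue (S.fidelity X T ω) - S.occValue (S.fidelity X 0 ω)) / T) atTop (𝓝 0) := by
      refine squeeze_zero_norm (fun T => ?_)
        (tendsto_const_div_atTop_nhds_zero_nat (|S.pcon * (1 - a)| * (M + M)))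
      rw [Real.norm_eq_abs, abs_div, Nat.abs_cast, abs_mul]
      gcongr
      exact (abs_sub _ _).trans
        (add_le_add (hM _ (h.fidelity_mem X T ω)) (hM _ (h.fidelity_mem X 0 ω)))
    have := h2.sub hbd
    rw [sub_zero] at this
    refine this.congr fun T => ?_
    have e : ∀ t, S.step (S.fidelity X t ω) (X t ω) = S.fidelity X (t + 1) ω := fun _ => rfl
    simp only [e, Finset.sum_add_distrib, ← Finset.mul_sum,
      Finset.sum_range_sub fun t => S.occValue (S.fidelity X t ω)]
    rw [← sub_div, add_sub_cancel_right]
    simp only [ite_mul, one_mul, zero_mul]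
  refine ⟨infinite_of_tendsto_average hp hcount, ?_⟩
  refine (tendsto_average_nth hp hcount hserved).congr fun m => ?_
  refine congrArg _ (Finset.sum_congr rfl fun j _ => ?_)
  have hF := h.fidelity_mem X (Nat.nth (fun t => (X t ω).request = true) j) ω
  -- The shift by one in `requestTime` undoes the one in `fidelityBefore`: a request in the step
  -- from `t` finds a link iff `F(t) ≠ 0`, as decoherence keeps the fidelity at least `1/4`.
  simp only [requestTime, fidelityBefore, Nat.add_sub_cancel]
  by_cases h0 : S.fidelity X (Nat.nth (fun t => (X t ω).request = true) j) ω = 0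
  · simp [h0]
  · have := (h.decohere_mem (hF.resolve_left h0)).1
    have : 0 < S.decohere (S.fidelity X (Nat.nth (fun t => (X t ω).request = true) j) ω) := by
      linarith
    simp [h0, this]

end Buffer

theorem theorem1 (S : Buffer) (hn : 1 ≤ S.n)
    (hgen : S.pgen ∈ Set.Ioc (0 : ℝ) 1) (hcon : S.pcon ∈ Set.Ioc (0 : ℝ) 1)
    (hq : S.q ∈ Set.Icc (0 : ℝ) 1) (hΓ : 0 ≤ S.Γ) (hF : S.Fnew ∈ Set.Ioc (1 / 4 : ℝ) 1)
    (hpolicy : ∀ k ∈ Finset.Icc 1 S.n, (S.policy k).IsAdmissible)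
    {Ω : Type*} [MeasurableSpace Ω] (P : Measure Ω) [IsProbabilityMeasure P]
    (X : ℕ → Ω → StepOutcome S.n) (hmeas : ∀ t, Measurable (X t))
    (hindep : iIndepFun X P) (hlaw : ∀ t, P.map (X t) = S.stepLaw) :
    (∀ᵐ ω ∂P, S.HasAvailability X ω
      ((S.meanOccTime X P).toReal / ((S.meanGenTime X P).toReal + (S.meanOccTime X P).toReal))) ∧
    S.meanGenTime X P = ENNReal.ofReal (1 / (1 - (1 - S.pgen) ^ S.n)) ∧
    (1 - S.ATilde) * (1 - S.DTilde) - S.BTilde * S.CTilde ≠ 0 ∧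
    S.meanOccTime X P = ENNReal.ofReal
      ((1 - S.ATilde + S.CTilde * (S.Fnew - 1 / 4)) /
        (((1 - S.ATilde) * (1 - S.DTilde) - S.BTilde * S.CTilde) * S.PTilde)) := by
  have h : S.IsPhysical := ⟨hn, hgen, hcon, hq, hΓ, hF, hpolicy⟩
  have hgenTime := h.meanGenTime_eq hmeas hindep hlaw
  have hoccTime := h.meanOccTime_eq hmeas hindep hlaw
  refine ⟨?_, hgenTime, h.occDet_ne_zero, ?_⟩
  · rw [hgenTime, hoccTime, ENNReal.toReal_ofReal (one_div_pos.2 h.genProb_pos).le,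
      ENNReal.toReal_ofReal (h.occValue_Fnew_nonneg hmeas hindep hlaw)]
    exact h.ae_hasAvailability hmeas hindep hlaw
  · rw [hoccTime, Buffer.occValue_of_mem h.Fnew_mem_Icc, Buffer.occSlope, Buffer.occIntercept,
      Buffer.occDet]
    congr 1
    ring
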